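/- **Theorem.** A *lattice* is a discrete subgroup $\Lambda$ of $\mathbb{R}^2$ of rank $2$; its *density* is $1/|\det[u,v]|$, where $\{u,v\}$ is any basis of $\Lambda$. For a family $\mathcal F=\{R_1,\dots,R_n\}$, $n\ge 1$, of closed axis-parallel rectangles $R_i=w_i\times h_i$, a lattice is *$\mathcal F$-piercing* if it meets every translate of every $R_i$, and an *optimal $\mathcal F$-piercing lattice* is an $\mathcal F$-piercing lattice whose density is minimum among all $\mathcal F$-piercing lattices. There are an algorithm and a constant $C$ such that the following holds for every $n\ge1$ and every family $\mathcal F$ of $n$ axis-parallel rectangles with positive integer widths $w_i$ and heights $h_i$. Let $k=\max_i\max(w_i,h_i)$. Given the numbers $n,w_1,h_1,\dots,w_n,h_n$, the algorithm finds an optimal $\mathcal F$-piercing lattice in at most $$C\,k^{18}(k+n)\log(k+1)$$ steps, that is, in $O\!\left(k^{18}(k+n)\log k\right)$ time for $k\ge 2$. Its output is a basis $u=(a,b)$, $v=(c,d)$ of the lattice with rational coordinates, in which $a,c$ have a common denominator that is at most $Ck^2$, and so do $b,d$. Time is counted on a random-access machine with indirect addressing whose words hold the integers of absolute value at most $C(k+n)^C$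 (words of $O(\log(k+n))$ bits) and on which every arithmetic operation ($+,-,\times$, integer division), copying of a word, and test takes one step. -/

import Mathlib

/-! ### The random-access machine -/

namespace RAM

/-- The memory: an integer in every cell, cells being addressed by integers. -/
abbrev Memory : Type := ℤ → ℤ

/-- The arithmetic operations of the machine. -/
inductive Op : Type
  | add
  | sub
  | mul
  | div

/-- `div` is Euclidean division of integers (with quotient `0` if the divisor is `0`). -/
def Op.eval : Op → ℤ → ℤ → ℤ
  | .add, x, y => x + y
  | .sub, x, y => x - y
  | .mul, x, y => x * y
  | .div, x, y => x / y

/-- Programs of a random-access machine, in structured form. The letters `d`, `x`, `y` are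
addresses of cells, fixed by the program; `load` and `store` use indirect addressing.
* `const d c`  : `M[d] := c`
* `op o d x y` : `M[d] := M[x] o M[y]`
* `load d x`   : `M[d] := M[M[x]]`
* `store d x`  : `M[M[d]] := M[x]`
* `ifPos x p q` : if `M[x] > 0` then run `p`, else run `q`
* `whilePos x p` : as long as `M[x] > 0`, run `p`. -/
inductive Program : Type
  | skip
  | const (d c : ℤ)
  | op (o : Op) (d x y : ℤ)
  | load (d x : ℤ)
  | store (d x : ℤ)
  | seq (p q : Program)
  | ifPos (x : ℤ) (p q : Program)
  | whilePos (x : ℤ) (p : Program)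

/-- `Runs B p M t M'`: on a machine whose words hold the integers of absolute value at most `B`,
the program `p`, started with memory `M`, halts after exactly `t` steps with memory `M'`.
Every elementary instruction and every evaluation of a test is one step. An attempt to write
an integer that does not fit into a word is a crash: no rule applies. The rules are
deterministic: for given `B`, `p`, `M` there is at most one pair `t`, `M'`. -/
inductive Runs (B : ℕ) : Program → Memory → ℕ → Memory → Prop
  | skip (M : Memory) : Runs B .skip M 1 M
  | const (M : Memory) (d c : ℤ) (hB : |c| ≤ (B : ℤ)) :
      Runs B (.const d c) M 1 (Function.update M d c)
  | op (M : Memory) (o : Op) (d x y : ℤ) (hB : |o.eval (M x) (M y)| ≤ (B : ℤ)) :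
      Runs B (.op o d x y) M 1 (Function.update M d (o.eval (M x) (M y)))
  | load (M : Memory) (d x : ℤ) (hB : |M (M x)| ≤ (B : ℤ)) :
      Runs B (.load d x) M 1 (Function.update M d (M (M x)))
  | store (M : Memory) (d x : ℤ) (hB : |M x| ≤ (B : ℤ)) :
      Runs B (.store d x) M 1 (Function.update M (M d) (M x))
  | seq {p q : Program} {M M' M'' : Memory} {s t : ℕ} (hp : Runs B p M s M')
      (hq : Runs B q M' t M'') : Runs B (.seq p q) M (s + t) M''
  | if_pos {p q : Program} {M M' : Memory} {t : ℕ} {x : ℤ} (hx : 0 < M x)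
      (hp : Runs B p M t M') : Runs B (.ifPos x p q) M (t + 1) M'
  | if_neg {p q : Program} {M M' : Memory} {t : ℕ} {x : ℤ} (hx : ¬ 0 < M x)
      (hq : Runs B q M t M') : Runs B (.ifPos x p q) M (t + 1) M'
  | while_pos {p : Program} {M M' M'' : Memory} {s t : ℕ} {x : ℤ} (hx : 0 < M x)
      (hp : Runs B p M s M') (hw : Runs B (.whilePos x p) M' t M'') :
      Runs B (.whilePos x p) M (s + t + 1) M''
  | while_neg {p : Program} {M : Memory} {x : ℤ} (hx : ¬ 0 < M x) :
      Runs B (.whilePos x p) M 1 M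

end RAM

/-! ### Lattices that pierce a family of rectangles -/

namespace Piercing

/-- The plane. -/
abbrev Plane : Type := Fin 2 → ℝ

/-- The closed axis-parallel `w × h` rectangle with lower left corner `p`; for fixed `w` and `h`
these are the translates of one rectangle. -/
def rect (w h : ℝ) (p : Plane) : Set Plane := Set.Icc p (p + ![w, h])

/-- A point set pierces a family of rectangles if it meets every translate of each of them. -/
def IsPiercing {n : ℕ} (w h : Fin n → ℕ) (P : Set Plane) : Prop :=
  ∀ (i : Fin n) (p : Plane), (P ∩ rect (w i) (h i) p).Nonempty

/-- A lattice of the plane: a discrete subgroup that spans the plane over `ℝ`. -/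
def IsLattice (L : Submodule ℤ Plane) : Prop :=
  ∃ _ : DiscreteTopology L, IsZLattice ℝ L

/-- The density of a lattice: the reciprocal of the area of a fundamental parallelogram. -/
noncomputable def density (L : Submodule ℤ Plane) : ℝ := 1 / ZLattice.covolume L

/-- `L` is an optimal piercing lattice: it has the least density among all piercing lattices. -/
def IsOptimalPiercingLattice {n : ℕ} (w h : Fin n → ℕ) (L : Submodule ℤ Plane) : Prop :=
  IsLattice L ∧ IsPiercing w h (L : Set Plane) ∧
    ∀ L' : Submodule ℤ Plane, IsLattice L' → IsPiercing w h (L' : Set Plane) →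
      density L ≤ density L'

/-- The largest width or height of a rectangle of the family. -/
def maxExtent {n : ℕ} (w h : Fin n → ℕ) : ℕ :=
  Finset.univ.sup fun i => max (w i) (h i)

/-- The input: `M[0] = n`, `M[2i+1] = wᵢ`, `M[2i+2] = hᵢ` for `0 ≤ i < n`,
and `0` in all other cells. -/
def inputMemory {n : ℕ} (w h : Fin n → ℕ) : RAM.Memory := fun z =>
  if z = 0 then (n : ℤ)
  else ∑ i : Fin n, ((if z = 2 * (i : ℤ) + 1 then (w i : ℤ) else 0) +
    (if z = 2 * (i : ℤ) + 2 then (h i : ℤ) else 0))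

/-- The output is a pair of vectors with rational coordinates. The denominator of both
`x`-coordinates is in `M[0]`, that of both `y`-coordinates in `M[1]`; the numerators of the
first vector are in `M[2]` and `M[3]`, those of the second one in `M[4]` and `M[5]`. -/
noncomputable def outputVectors (M : RAM.Memory) : Fin 2 → Plane :=
  ![![(M 2 : ℝ) / (M 0 : ℝ), (M 3 : ℝ) / (M 1 : ℝ)],
    ![(M 4 : ℝ) / (M 0 : ℝ), (M 5 : ℝ) / (M 1 : ℝ)]]

end Piercing

/-! In a piercing lattice let u = (a, b) be the leftmost point of the strip 0 ≤ y ≤ h to the right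
of the origin or straight above it, and v = (c, -d) the leftmost point with x > 0 and -h ≤ y < 0.
Then u, v is a basis, and piercing the w × h rectangle forces a + c ≤ w besides b, d ≤ h
(`exists_basis_of_pierces`). Conversely, every such basis pierces (`gen_pierces`). So piercing is
certified by linear inequalities on bases, with one basis for each rectangle.

Write the bases of all rectangles as integral combinations of one of them and freeze the
coefficients. The inequalities split into a polygon for (a, c) and a polygon for (b, d), and the
determinant ad + bc is linear in either pair. Moving first (a, c) and then (b, d) to a vertex does
not decrease the determinant, so the density does not increase. By Cramer's rule the vertices are
rational, with minors of the system as denominators. Such a minor times the determinant is, up to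
sign, a minor in coordinates of size at most k; hence the denominators are at most 2k² if the
determinant is at least 1 (`abs_minor_le`, `exists_rational_lattice`). If it is less than 1, the
integer lattice is better. So every piercing lattice is dominated by one of O(k¹⁶) candidates, and
an optimum exists among them.

A candidate is tested against one rectangle by a subtractive Euclidean walk through its bases: while
a + c ≤ w and some vector is too tall, the steeper vector is replaced by u + v. A certificate found
in this way is sound since the lattice never changes, and for the relevant candidates a potential
shows that 3k² + 1 steps suffice (`Coords.Pierced.accepts`). The exhaustive search takes O(k¹⁸ n)
steps, which is within the bound because log (k + 1) ≥ 1/2.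

The machine works in negative cells and leaves the input intact until the output is written. Inner
subprograms mostly use lower cells than outer ones, so that their effects on outer data are excluded
by frame conditions "all cells from some address on are unchanged". -/

namespace Piercing

/-! ### Lattices generated by a vector of the first and a vector of the fourth quadrant -/

/-- The subgroup generated by `(a, b)` and `(c, -d)`. -/
def gen (a b c d : ℝ) : Submodule ℤ Plane := Submodule.span ℤ {![a, b], ![c, -d]}

theorem mem_gen {a b c d : ℝ} {p : Plane} :
    p ∈ gen a b c d ↔ ∃ i j : ℤ, p 0 = i * a + j * c ∧ p 1 = i * b - j * d := by
  unfold gen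
  rw [Submodule.mem_span_pair]
  refine exists_congr fun i => exists_congr fun j => ⟨?_, ?_⟩
  · rintro rfl
    constructor
    · simp
    · simp [sub_eq_add_neg]
  · rintro ⟨h0, h1⟩
    ext t
    fin_cases t
    · simp [h0]
    · simp [h1, sub_eq_add_neg]

/-- `P` meets every translate of the closed `w × h` rectangle. -/
def Pierces (w h : ℝ) (P : Set Plane) : Prop :=
  ∀ x y : ℝ, ∃ q ∈ P, x ≤ q 0 ∧ q 0 ≤ x + w ∧ y ≤ q 1 ∧ q 1 ≤ y + h

theorem forall_rect_nonempty_iff {w h : ℝ} {P : Set Plane} :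
    (∀ p, (P ∩ rect w h p).Nonempty) ↔ Pierces w h P := by
  constructor
  · intro H x y
    obtain ⟨q, hq, hr⟩ := H ![x, y]
    refine ⟨q, hq, ?_⟩
    have h1 := hr.1
    have h2 := hr.2
    rw [Pi.le_def] at h1 h2
    have a0 := h1 0
    have a1 := h1 1
    have b0 := h2 0
    have b1 := h2 1
    simp at a0 a1 b0 b1
    exact ⟨a0, b0, a1, b1⟩
  · intro H p
    obtain ⟨q, hq, h1, h2, h3, h4⟩ := H (p 0) (p 1)
    refine ⟨q, hq, ?_, ?_⟩
    · intro t
      fin_cases t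
      · exact h1
      · exact h3
    · intro t
      fin_cases t
      · simpa using h2
      · simpa using h4

theorem isPiercing_iff {n : ℕ} {w h : Fin n → ℕ} {P : Set Plane} :
    IsPiercing w h P ↔ ∀ i, Pierces (w i) (h i) P :=
  forall_congr' fun _ => forall_rect_nonempty_iff

theorem Pierces.mono {w h : ℝ} {P Q : Set Plane} (hP : Pierces w h P) (hPQ : P ⊆ Q) :
    Pierces w h Q := fun x y =>
  let ⟨q, hq, H⟩ := hP x y
  ⟨q, hPQ hq, H⟩

/-- A lattice with a short basis pierces. -/
theorem gen_pierces {a b c d w h : ℝ} (ha : 0 ≤ a) (hb : 0 ≤ b) (hc : 0 ≤ c) (hd : 0 ≤ d)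
    (hdet : 0 < a * d + b * c) (hw : a + c ≤ w) (hbh : b ≤ h) (hdh : d ≤ h) :
    Pierces w h (gen a b c d) := by
  intro x y
  -- the translate of `-(x, y)` into the fundamental parallelogram
  obtain ⟨i, j, s, t, hs0, hs1, ht0, ht1, hX, hY⟩ : ∃ (i j : ℤ) (s t : ℝ), 0 ≤ s ∧ s < 1 ∧
      0 ≤ t ∧ t < 1 ∧ i * a + j * c - x = s * a + t * c ∧ i * b - j * d - y = s * b - t * d := by
    have hne : a * d + b * c ≠ 0 := hdet.ne'
    set S := (-x * d - y * c) / (a * d + b * c) with hS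
    set T := (y * a - x * b) / (a * d + b * c) with hT
    have e1 : S * a + T * c = -x := by rw [hS, hT, div_mul_eq_mul_div, div_mul_eq_mul_div, ← add_div, div_eq_iff hne]; ring
    have e2 : S * b - T * d = -y := by rw [hS, hT, div_mul_eq_mul_div, div_mul_eq_mul_div, ← sub_div, div_eq_iff hne]; ring
    refine ⟨-⌊S⌋, -⌊T⌋, Int.fract S, Int.fract T, Int.fract_nonneg _, Int.fract_lt_one _,
      Int.fract_nonneg _, Int.fract_lt_one _, ?_, ?_⟩
    · rw [Int.fract, Int.fract]; push_cast; linear_combination -e1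
    · rw [Int.fract, Int.fract]; push_cast; linear_combination -e2
  have key : ∀ k l : ℤ, 0 ≤ s * a + t * c + k * a + l * c → s * a + t * c + k * a + l * c ≤ w →
      0 ≤ s * b - t * d + k * b - l * d → s * b - t * d + k * b - l * d ≤ h →
      ∃ q ∈ (gen a b c d : Set Plane), x ≤ q 0 ∧ q 0 ≤ x + w ∧ y ≤ q 1 ∧ q 1 ≤ y + h := by
    intro k l h1 h2 h3 h4
    refine ⟨![(i + k : ℤ) * a + (j + l : ℤ) * c, (i + k : ℤ) * b - (j + l : ℤ) * d],
      mem_gen.2 ⟨i + k, j + l, rfl, rfl⟩, ?_⟩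
    simp only [Matrix.cons_val_zero, Matrix.cons_val_one]
    push_cast
    refine ⟨by linarith, by linarith, by linarith, by linarith⟩
  set X := s * a + t * c with hXd
  set Y := s * b - t * d with hYd
  have hX0 : 0 ≤ X := by positivity
  have hX1 : X ≤ a + c := by nlinarith
  have hY1 : Y ≤ b := by nlinarith
  have hY0 : -d ≤ Y := by nlinarith
  rcases le_or_gt 0 Y with hYpos | hYneg
  · exact key 0 0 (by simpa using hX0) (by simpa using by linarith) (by simpa using hYpos)
      (by simpa using by linarith)
  -- The point lies below the target by at most d. Add u until the abscissa reaches c or the height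
  -- reaches 0. Just before that the abscissa was below c and the height negative, so now they are
  -- at most a + c and b. If the height is still negative, subtracting v lands in the rectangle.
  have hex : ∃ m : ℕ, c ≤ X + m * a ∨ 0 ≤ Y + m * b := by
    rcases ha.lt_or_eq with ha' | ha'
    · obtain ⟨m, hm⟩ := exists_nat_ge (c / a)
      refine ⟨m, Or.inl ?_⟩
      rw [div_le_iff₀ ha'] at hm
      linarith
    · have hb' : 0 < b := by
        rcases hb.lt_or_eq with h | h
        · exact h
        · rw [← ha', ← h] at hdet; simp at hdet
      obtain ⟨m, hm⟩ := exists_nat_ge (-Y / b)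
      refine ⟨m, Or.inr ?_⟩
      rw [div_le_iff₀ hb'] at hm
      linarith
  classical
  have hm := Nat.find_spec hex
  have hmin := @Nat.find_min _ _ hex
  set m := Nat.find hex with hmdef
  clear_value m
  have hprev : m = 0 ∨ (X + m * a < a + c ∧ Y + m * b < b) := by
    rcases Nat.eq_zero_or_pos m with h0 | hpos
    · exact Or.inl h0
    · right
      have := hmin (m := m - 1) (by omega)
      rw [not_or, not_le, not_le, Nat.cast_sub hpos] at this
      push_cast at this
      constructor <;> linarith [this.1, this.2]
  have hma : 0 ≤ (m : ℝ) * a := by positivity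
  have hmb : 0 ≤ (m : ℝ) * b := by positivity
  rcases le_or_gt 0 (Y + m * b) with h0 | h0
  · rcases hprev with h1 | ⟨h1, h2⟩
    · rw [h1] at h0; simp at h0; linarith
    · exact key m 0 (by push_cast; linarith) (by push_cast; linarith) (by push_cast; linarith)
        (by push_cast; linarith)
  · have hc' : c ≤ X + m * a := hm.resolve_right (not_le.2 h0)
    have hxa : X + m * a ≤ a + c := by
      rcases hprev with h1 | ⟨h1, h2⟩
      · rw [h1]; simpa using hX1
      · exact h1.le
    exact key m (-1) (by push_cast; linarith) (by push_cast; linarith) (by push_cast; linarith)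
      (by push_cast; linarith)

/-- The open rectangle spanned by the basis is free of lattice points. -/
theorem Pierces.le_or_le {a b c d w h : ℝ} (ha : 0 ≤ a) (hb : 0 ≤ b) (hc : 0 ≤ c) (hd : 0 ≤ d)
    (hP : Pierces w h (gen a b c d)) : a + c ≤ w ∨ b + d ≤ h := by
  by_contra! H
  -- The rectangle is centred in the open box 0 < x < a + c, -d < y < b. The signs of the two
  -- coefficients of a lattice point decide which side of this box it violates.
  obtain ⟨q, hq, h1, h2, h3, h4⟩ := hP ((a + c - w) / 2) (-d + (b + d - h) / 2)
  obtain ⟨i, j, e0, e1⟩ := mem_gen.1 hq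
  rw [e0] at h1 h2
  rw [e1] at h3 h4
  have hx0 : 0 < i * a + j * c := by linarith
  have hx1 : i * a + j * c < a + c := by linarith
  have hy0 : -d < i * b - j * d := by linarith
  have hy1 : i * b - j * d < b := by linarith
  rcases le_or_gt i 0 with hi | hi <;> rcases le_or_gt j 0 with hj | hj
  · have hi' : (i : ℝ) ≤ 0 := by exact_mod_cast hi
    have hj' : (j : ℝ) ≤ 0 := by exact_mod_cast hj
    nlinarith
  · have hi' : (i : ℝ) ≤ 0 := by exact_mod_cast hi
    have hj' : (1 : ℝ) ≤ j := by exact_mod_cast hj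
    nlinarith
  · have hi' : (1 : ℝ) ≤ i := by exact_mod_cast hi
    have hj' : (j : ℝ) ≤ 0 := by exact_mod_cast hj
    nlinarith
  · have hi' : (1 : ℝ) ≤ i := by exact_mod_cast hi
    have hj' : (1 : ℝ) ≤ j := by exact_mod_cast hj
    nlinarith

theorem linearIndependent_of_det_pos {a b c d : ℝ} (hdet : 0 < a * d + b * c) :
    LinearIndependent ℝ ![(![a, b] : Plane), ![c, -d]] := by
  rw [LinearIndependent.pair_iff]
  intro s t hst
  have h0 := congrFun hst 0
  have h1 := congrFun hst 1
  simp at h0 h1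
  constructor
  · have : s * (a * d + b * c) = 0 := by linear_combination d * h0 + c * h1
    exact (mul_eq_zero.1 this).resolve_right hdet.ne'
  · have : t * (a * d + b * c) = 0 := by linear_combination b * h0 - a * h1
    exact (mul_eq_zero.1 this).resolve_right hdet.ne'

theorem gen_eq_span_range (a b c d : ℝ) :
    gen a b c d = Submodule.span ℤ (Set.range ![(![a, b] : Plane), ![c, -d]]) := by
  rw [gen]
  congr 1
  simp [Matrix.range_cons, Matrix.range_empty, Set.pair_comm]

theorem isLattice_gen {a b c d : ℝ} (hdet : 0 < a * d + b * c) : IsLattice (gen a b c d) := by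
  have hli := linearIndependent_of_det_pos hdet
  let B := basisOfLinearIndependentOfCardEqFinrank hli (by simp)
  have hB : ⇑B = ![(![a, b] : Plane), ![c, -d]] :=
    coe_basisOfLinearIndependentOfCardEqFinrank hli (by simp)
  rw [gen_eq_span_range, ← hB]
  exact ⟨inferInstance, inferInstance⟩

theorem covolume_gen {a b c d : ℝ} (hdet : 0 < a * d + b * c) :
    ZLattice.covolume (gen a b c d) = a * d + b * c := by
  have hli := linearIndependent_of_det_pos hdet
  let B := basisOfLinearIndependentOfCardEqFinrank hli (by simp)
  have hB : ⇑B = ![(![a, b] : Plane), ![c, -d]] :=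
    coe_basisOfLinearIndependentOfCardEqFinrank hli (by simp)
  rw [gen_eq_span_range, ← hB, ZLattice.covolume_eq_det _ (B.restrictScalars ℤ)]
  have : ((↑) ∘ ⇑(B.restrictScalars ℤ) : Fin 2 → Plane) = ![(![a, b] : Plane), ![c, -d]] := by
    rw [← hB]
    ext1 i
    simp
  rw [this, Matrix.det_fin_two]
  simp
  rw [show -(a * d) - b * c = -(a * d + b * c) by ring, abs_neg, abs_of_pos hdet]

/-! ### Short bases of piercing lattices -/

theorem finite_inter_of_discrete (L : Submodule ℤ Plane) [DiscreteTopology L] {s : Set Plane}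
    (hs : Bornology.IsBounded s) : (s ∩ L).Finite := by
  refine Metric.finite_isBounded_inter_isClosed DiscreteTopology.isDiscrete hs ?_
  rw [← Submodule.coe_toAddSubgroup]
  exact @AddSubgroup.isClosed_of_discrete _ _ _ _ _ L.toAddSubgroup
    (inferInstanceAs <| DiscreteTopology L)

theorem finite_box (L : Submodule ℤ Plane) [DiscreteTopology L] (x₀ x₁ y₀ y₁ : ℝ) :
    {p : Plane | p ∈ L ∧ x₀ ≤ p 0 ∧ p 0 ≤ x₁ ∧ y₀ ≤ p 1 ∧ p 1 ≤ y₁}.Finite := by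
  refine (finite_inter_of_discrete L (Metric.isBounded_Icc ![x₀, y₀] ![x₁, y₁])).subset ?_
  rintro p ⟨hp, h1, h2, h3, h4⟩
  refine ⟨⟨?_, ?_⟩, hp⟩ <;> intro t <;> fin_cases t <;> simp_all

/-- Lexicographic minimum of a nonempty subset of a discrete group lying in the strip
`0 ≤ x`, `y₀ ≤ y ≤ y₁`. -/
theorem exists_lex_min (L : Submodule ℤ Plane) [DiscreteTopology L] (y₀ y₁ : ℝ) (S : Set Plane)
    (hS : ∀ p ∈ S, p ∈ L ∧ 0 ≤ p 0 ∧ y₀ ≤ p 1 ∧ p 1 ≤ y₁) (hne : S.Nonempty) :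
    ∃ p ∈ S, ∀ q ∈ S, p 0 < q 0 ∨ (p 0 = q 0 ∧ p 1 ≤ q 1) := by
  obtain ⟨r, hr⟩ := hne
  -- Points to the right of `r` cannot be minimal, and what remains of the strip is a bounded box.
  have hfin : {p | p ∈ S ∧ p 0 ≤ r 0}.Finite := by
    refine (finite_box L 0 (r 0) y₀ y₁).subset ?_
    rintro p ⟨hp, h1⟩
    obtain ⟨a1, a2, a3, a4⟩ := hS p hp
    exact ⟨a1, a2, h1, a3, a4⟩
  obtain ⟨p, hp, hmin⟩ := Set.exists_min_image _ (fun p : Plane => toLex (p 0, p 1)) hfin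
    ⟨r, hr, le_refl _⟩
  refine ⟨p, hp.1, fun q hq => ?_⟩
  rcases lt_or_ge (r 0) (q 0) with h | h
  · exact Or.inl (lt_of_le_of_lt hp.2 h)
  · have := hmin q ⟨hq, h⟩
    rw [Prod.Lex.toLex_le_toLex] at this
    exact this

/-- The half-open parallelogram spanned by the two extremal vectors contains no other
element of the group. -/
theorem parallelogram_empty {T : ℝ → ℝ → Prop} {a b c d h : ℝ}
    (hsub : ∀ x y x' y', T x y → T x' y' → T (x - x') (y - y'))
    (hab : 0 < a ∨ (a = 0 ∧ 0 < b)) (hb : 0 ≤ b) (hbh : b ≤ h) (hc : 0 < c) (hd : 0 < d)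
    (hdh : d ≤ h) (hu : T a b) (hv : T c (-d))
    (hU : ∀ x y, T x y → 0 ≤ x → 0 < y → y ≤ h → a < x ∨ (a = x ∧ b ≤ y))
    (hU' : ∀ x y, T x y → 0 < x → 0 ≤ y → y ≤ h → a ≤ x)
    (hV : ∀ x y, T x y → 0 < x → -h ≤ y → y < 0 → c ≤ x)
    {s t : ℝ} (hs0 : 0 ≤ s) (hs1 : s < 1) (ht0 : 0 ≤ t) (ht1 : t < 1)
    (hp : T (s * a + t * c) (s * b - t * d)) : s = 0 ∧ t = 0 := by
  have ha : 0 ≤ a := by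
    rcases hab with h1 | h1
    · exact h1.le
    · exact h1.1.ge
  have hsa : 0 ≤ s * a := mul_nonneg hs0 ha
  have hsb : 0 ≤ s * b := mul_nonneg hs0 hb
  have htc : 0 ≤ t * c := mul_nonneg ht0 hc.le
  have htd : 0 ≤ t * d := mul_nonneg ht0 hd.le
  have hsa' : s * a ≤ a := by nlinarith
  have hsb' : s * b ≤ b := by nlinarith
  have htc' : t * c < c := by nlinarith
  have htd' : t * d < d := by nlinarith
  rcases ht0.lt_or_eq with ht | ht
  · exfalso
    have htc0 : 0 < t * c := mul_pos ht hc
    have htd0 : 0 < t * d := mul_pos ht hd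
    -- A point below the axis has abscissa at least c, and subtracting v gives a point of the upper
    -- strip to the left of u. A point on or above the axis has abscissa at least a, and subtracting
    -- u gives a point of the lower strip to the left of v, unless the abscissa equals a; then u
    -- minus the point is vertical and forces a = 0.
    rcases lt_or_ge (s * b - t * d) 0 with hy | hy
    · have h1 := hV _ _ hp (by linarith) (by linarith) hy
      have h2 := hU _ _ (hsub _ _ _ _ hp hv) (by linarith) (by linarith) (by linarith)
      rcases h2 with h2 | h2
      · linarith
      · linarith [h2.1]
    · have h1 := hU' _ _ hp (by linarith) hy (by linarith)
      rcases h1.lt_or_eq with h2 | h2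
      · have h3 := hV _ _ (hsub _ _ _ _ hp hu) (by linarith) (by linarith) (by linarith)
        linarith
      · have h3 := hU _ _ (hsub _ _ _ _ hu hp) (by linarith) (by linarith) (by linarith)
        have ha0 : a = 0 := by
          rcases h3 with h3 | h3
          · linarith
          · linarith [h3.1]
        rw [ha0] at h2
        linarith
  · refine ⟨?_, ht.symm⟩
    by_contra hs
    have hs' : 0 < s := hs0.lt_of_ne fun h => hs h.symm
    rw [← ht, zero_mul, zero_mul, add_zero, sub_zero] at hp
    rcases hab with h1 | ⟨h1, h2⟩
    · have h3 := hU' _ _ hp (mul_pos hs' h1) hsb (by linarith)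
      nlinarith
    · have h3 := hU _ _ hp hsa (mul_pos hs' h2) (by linarith)
      rcases h3 with h3 | h3
      · linarith
      · nlinarith [h3.2]

/-- A piercing lattice has a short basis. -/
theorem exists_basis_of_pierces {L : Submodule ℤ Plane} (hL : IsLattice L) {w h : ℝ} (hh : 0 < h)
    (hP : Pierces w h L) :
    ∃ a b c d : ℝ, 0 ≤ a ∧ 0 ≤ b ∧ 0 ≤ c ∧ 0 ≤ d ∧ 0 < a * d + b * c ∧ L = gen a b c d ∧
      a + c ≤ w ∧ b ≤ h ∧ d ≤ h := by
  obtain ⟨hdisc, -⟩ := hL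
  obtain ⟨u, ⟨huL, hu1, hu2, hu3⟩, humin⟩ := exists_lex_min L 0 h
    {p | p ∈ L ∧ (0 < p 0 ∨ (p 0 = 0 ∧ 0 < p 1)) ∧ 0 ≤ p 1 ∧ p 1 ≤ h}
    (by
      rintro p ⟨h1, h2, h3, h4⟩
      refine ⟨h1, ?_, h3, h4⟩
      rcases h2 with h2 | h2
      · exact h2.le
      · exact h2.1.ge)
    (by
      obtain ⟨q, hq, h1, h2, h3, h4⟩ := hP 1 0
      exact ⟨q, hq, Or.inl (by linarith), h3, by linarith⟩)
  obtain ⟨v, ⟨hvL, hv1, hv2, hv3⟩, hvmin⟩ := exists_lex_min L (-h) 0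
    {p | p ∈ L ∧ 0 < p 0 ∧ -h ≤ p 1 ∧ p 1 < 0}
    (by
      rintro p ⟨h1, h2, h3, h4⟩
      exact ⟨h1, h2.le, h3, h4.le⟩)
    (by
      -- A rectangle in -h ≤ y ≤ 0 might be hit only on the axis. Therefore take the highest lattice
      -- point below the axis in a slightly deeper box. Were it lower than -h, a translate of the
      -- rectangle would fit strictly between it and the axis and contain a higher point.
      have hfin : {p : Plane | p ∈ L ∧ 1 ≤ p 0 ∧ p 0 ≤ 1 + w ∧ -h - 1 ≤ p 1 ∧ p 1 < 0}.Finite :=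
        (finite_box L 1 (1 + w) (-h - 1) 0).subset fun p hp =>
          ⟨hp.1, hp.2.1, hp.2.2.1, hp.2.2.2.1, hp.2.2.2.2.le⟩
      obtain ⟨q, ⟨hq, h1, h2, h3, h4⟩, hmax⟩ := Set.exists_max_image _ (fun p : Plane => p 1) hfin
        (by
          obtain ⟨q, hq, h1, h2, h3, h4⟩ := hP 1 (-h - 1 / 2)
          exact ⟨q, hq, h1, h2, by linarith, by linarith⟩)
      refine ⟨q, hq, by linarith, ?_, h4⟩
      by_contra! hlt
      obtain ⟨r, hr, g1, g2, g3, g4⟩ := hP 1 ((q 1 - h) / 2)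
      have := hmax r ⟨hr, g1, g2, by linarith, by linarith⟩
      linarith)
  set a := u 0 with ha_def
  set b := u 1 with hb_def
  set c := v 0 with hc_def
  set d := -v 1 with hd_def
  have hvd : v 1 = -d := by rw [hd_def]; ring
  have ha : 0 ≤ a := by
    rcases hu1 with h1 | h1
    · exact h1.le
    · exact h1.1.ge
  have hd : 0 < d := by linarith
  have hdh : d ≤ h := by linarith
  have hdet : 0 < a * d + b * c := by
    rcases hu1 with h1 | ⟨h1, h2⟩
    · have := mul_pos h1 hd
      nlinarith
    · have := mul_pos h2 hv1
      nlinarith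
  -- the two extremal properties in terms of coordinates
  have hU : ∀ p ∈ L, 0 ≤ p 0 → 0 < p 1 → p 1 ≤ h → a < p 0 ∨ (a = p 0 ∧ b ≤ p 1) := by
    intro p hp h1 h2 h3
    refine humin p ⟨hp, ?_, h2.le, h3⟩
    rcases h1.lt_or_eq with h4 | h4
    · exact Or.inl h4
    · exact Or.inr ⟨h4.symm, h2⟩
  have hU' : ∀ p ∈ L, 0 < p 0 → 0 ≤ p 1 → p 1 ≤ h → a ≤ p 0 := by
    intro p hp h1 h2 h3
    rcases humin p ⟨hp, Or.inl h1, h2, h3⟩ with h4 | h4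
    · exact h4.le
    · exact h4.1.le
  have hV : ∀ p ∈ L, 0 < p 0 → -h ≤ p 1 → p 1 < 0 → c < p 0 ∨ (c = p 0 ∧ -d ≤ p 1) := by
    intro p hp h1 h2 h3
    have := hvmin p ⟨hp, h1, h2, h3⟩
    rw [hvd] at this
    exact this
  have hbasis : L = gen a b c d := by
    apply le_antisymm
    · intro p hp
      have hne : a * d + b * c ≠ 0 := hdet.ne'
      set S := (p 0 * d + p 1 * c) / (a * d + b * c) with hS
      set T := (p 0 * b - p 1 * a) / (a * d + b * c) with hT
      have e1 : S * a + T * c = p 0 := by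
        rw [hS, hT, div_mul_eq_mul_div, div_mul_eq_mul_div, ← add_div, div_eq_iff hne]; ring
      have e2 : S * b - T * d = p 1 := by
        rw [hS, hT, div_mul_eq_mul_div, div_mul_eq_mul_div, ← sub_div, div_eq_iff hne]; ring
      set s := Int.fract S with hs
      set t := Int.fract T with ht
      have hs0 : 0 ≤ s := Int.fract_nonneg _
      have hs1 : s < 1 := Int.fract_lt_one _
      have ht0 : 0 ≤ t := Int.fract_nonneg _
      have ht1 : t < 1 := Int.fract_lt_one _
      set p' : Plane := p - ⌊S⌋ • u - ⌊T⌋ • v with hp'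
      have hp'L : p' ∈ L := L.sub_mem (L.sub_mem hp (L.smul_mem _ huL)) (L.smul_mem _ hvL)
      have f0 : p' 0 = s * a + t * c := by
        simp only [hp', Pi.sub_apply, Pi.smul_apply]
        simp only [zsmul_eq_mul, hs, ht, Int.fract]
        rw [← ha_def, ← hc_def]
        linear_combination -e1
      have f1 : p' 1 = s * b - t * d := by
        simp only [hp', Pi.sub_apply, Pi.smul_apply]
        simp only [zsmul_eq_mul, hs, ht, Int.fract]
        rw [← hb_def, hvd]
        linear_combination -e2
      have hst : s = 0 ∧ t = 0 := by
        refine parallelogram_empty (T := fun x y => ∃ q ∈ L, q 0 = x ∧ q 1 = y) ?_ hu1 hu2 hu3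
          hv1 hd hdh ⟨u, huL, rfl, rfl⟩ ⟨v, hvL, rfl, hvd⟩ ?_ ?_ ?_ hs0 hs1 ht0 ht1
          ⟨p', hp'L, f0, f1⟩
        · rintro x y x' y' ⟨q, hq, rfl, rfl⟩ ⟨r, hr, rfl, rfl⟩
          exact ⟨q - r, L.sub_mem hq hr, rfl, rfl⟩
        · rintro x y ⟨q, hq, rfl, rfl⟩
          exact hU q hq
        · rintro x y ⟨q, hq, rfl, rfl⟩
          exact hU' q hq
        · rintro x y ⟨q, hq, rfl, rfl⟩ h1 h2 h3
          rcases hV q hq h1 h2 h3 with h4 | h4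
          · exact h4.le
          · exact h4.1.le
      refine mem_gen.2 ⟨⌊S⌋, ⌊T⌋, ?_, ?_⟩
      · rw [hst.1, hst.2] at f0
        simp only [hp', Pi.sub_apply, Pi.smul_apply] at f0
        simp only [zsmul_eq_mul] at f0
        rw [← ha_def, ← hc_def] at f0
        linarith
      · rw [hst.1, hst.2] at f1
        simp only [hp', Pi.sub_apply, Pi.smul_apply] at f1
        simp only [zsmul_eq_mul] at f1
        rw [← hb_def, hvd] at f1
        linarith
    · rw [gen, Submodule.span_le]
      rintro p (rfl | rfl)
      · have : ![a, b] = u := by ext t; fin_cases t <;> simp [ha_def, hb_def]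
        rw [this]
        exact huL
      · have : ![c, -d] = v := by ext t; fin_cases t <;> simp [hc_def, hd_def]
        rw [this]
        exact hvL
  refine ⟨a, b, c, d, ha, hu2, hv1.le, hd.le, hdet, hbasis, ?_, hu3, hdh⟩
  -- Otherwise u - v or v - u lies in one of the two strips and contradicts the extremality of u or
  -- v.
  have hbd : h < b + d := by
    by_contra! hle
    rcases lt_trichotomy a c with hac | hac | hac
    · rcases hV (v - u) (L.sub_mem hvL huL) (by simp only [Pi.sub_apply]; linarith)
        (by simp only [Pi.sub_apply]; linarith) (by simp only [Pi.sub_apply]; linarith) with h1 | h1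
      · simp only [Pi.sub_apply] at h1; linarith
      · simp only [Pi.sub_apply] at h1
        have ha0 : a = 0 := by linarith [h1.1]
        have hb0 : b ≤ 0 := by linarith [h1.2]
        rcases hu1 with h2 | h2
        · linarith
        · linarith [h2.2]
    · rcases hU (u - v) (L.sub_mem huL hvL) (by simp only [Pi.sub_apply]; linarith)
        (by simp only [Pi.sub_apply]; linarith) (by simp only [Pi.sub_apply]; linarith) with h1 | h1
      · simp only [Pi.sub_apply] at h1; linarith
      · simp only [Pi.sub_apply] at h1; linarith [h1.1]
    · rcases hU (u - v) (L.sub_mem huL hvL) (by simp only [Pi.sub_apply]; linarith)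
        (by simp only [Pi.sub_apply]; linarith) (by simp only [Pi.sub_apply]; linarith) with h1 | h1
      · simp only [Pi.sub_apply] at h1; linarith
      · simp only [Pi.sub_apply] at h1; linarith [h1.1]
  rw [hbasis] at hP
  exact (hP.le_or_le ha hu2 hv1.le hd.le).resolve_right (not_le.2 hbd)

/-! ### Vertices of polygons and rational lattices -/

open Filter Topology in
/-- A linear function on a bounded polygon attains its maximum in a vertex. -/
theorem exists_vertex {ι : Type*} [Finite ι] {p q m : ι → ℝ} {R : ℝ}
    (hR : ∀ x y, (∀ j, p j * x + q j * y ≤ m j) → |x| ≤ R ∧ |y| ≤ R) {x₀ y₀ : ℝ}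
    (h₀ : ∀ j, p j * x₀ + q j * y₀ ≤ m j) (α β : ℝ) :
    ∃ x y, (∀ j, p j * x + q j * y ≤ m j) ∧ α * x₀ + β * y₀ ≤ α * x + β * y ∧
      ∃ j j', p j * q j' - p j' * q j ≠ 0 ∧ p j * x + q j * y = m j ∧
        p j' * x + q j' * y = m j' := by
  set K : Set (ℝ × ℝ) := {z | ∀ j, p j * z.1 + q j * z.2 ≤ m j} with hK
  have hclosed : IsClosed K := by
    have : K = ⋂ j, {z : ℝ × ℝ | p j * z.1 + q j * z.2 ≤ m j} := by ext; simp [hK]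
    rw [this]
    exact isClosed_iInter fun j => isClosed_le (by fun_prop) (by fun_prop)
  have hcomp : IsCompact K := by
    refine (isCompact_Icc (a := ((-R, -R) : ℝ × ℝ)) (b := (R, R))).of_isClosed_subset hclosed ?_
    intro z hz
    obtain ⟨h1, h2⟩ := hR z.1 z.2 hz
    exact ⟨⟨(abs_le.1 h1).1, (abs_le.1 h2).1⟩, ⟨(abs_le.1 h1).2, (abs_le.1 h2).2⟩⟩
  set l : (ℝ × ℝ) →L[ℝ] ℝ := α • ContinuousLinearMap.fst ℝ ℝ ℝ +
    β • ContinuousLinearMap.snd ℝ ℝ ℝ with hl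
  have hlz : ∀ z : ℝ × ℝ, l z = α * z.1 + β * z.2 := fun z => by simp [hl]
  -- The maximisers form a compact exposed face. It has an extreme point, which is also extreme in
  -- the whole polygon.
  have hexp : IsExposed ℝ K (l.toExposed K) := ContinuousLinearMap.toExposed.isExposed
  have hne : (l.toExposed K).Nonempty := by
    obtain ⟨z, hz, hmax⟩ := hcomp.exists_isMaxOn ⟨(x₀, y₀), h₀⟩ l.continuous.continuousOn
    exact ⟨z, hz, fun y hy => hmax hy⟩
  obtain ⟨z, hz⟩ := (hexp.isCompact hcomp).extremePoints_nonempty hne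
  have hzK := hexp.isExtreme.extremePoints_subset_extremePoints hz
  have hzf := hz.1
  refine ⟨z.1, z.2, hzK.1, ?_, ?_⟩
  · have := hzf.2 (x₀, y₀) h₀
    rwa [hlz, hlz] at this
  by_contra! H
  -- If no two tight constraints are independent, some direction keeps all of them tight. Small
  -- moves both ways along it stay in the polygon, by continuity for the finitely many slack
  -- constraints; this contradicts extremality.
  obtain ⟨e₁, e₂, he, hperp⟩ : ∃ e₁ e₂ : ℝ, (e₁ ≠ 0 ∨ e₂ ≠ 0) ∧
      ∀ j, p j * z.1 + q j * z.2 = m j → p j * e₁ + q j * e₂ = 0 := by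
    by_cases h : ∃ j, p j * z.1 + q j * z.2 = m j ∧ (p j ≠ 0 ∨ q j ≠ 0)
    · obtain ⟨j, hj, hpq⟩ := h
      refine ⟨-q j, p j, ?_, fun j' hj' => ?_⟩
      · rcases hpq with h | h
        · exact Or.inr h
        · exact Or.inl (neg_ne_zero.2 h)
      · by_contra hcon
        exact H j j' (fun h => hcon (by linarith)) hj hj'
    · push Not at h
      refine ⟨1, 0, Or.inl one_ne_zero, fun j hj => ?_⟩
      simp [h j hj]
  have hev : ∀ᶠ ε in 𝓝 (0 : ℝ), ∀ j, p j * (z.1 + ε * e₁) + q j * (z.2 + ε * e₂) ≤ m j ∧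
      p j * (z.1 - ε * e₁) + q j * (z.2 - ε * e₂) ≤ m j := by
    rw [eventually_all]
    intro j
    by_cases hj : p j * z.1 + q j * z.2 = m j
    · have := hperp j hj
      refine Eventually.of_forall fun ε => ⟨?_, ?_⟩
      · linear_combination hj + ε * this
      · linear_combination hj - ε * this
    · have hlt : p j * z.1 + q j * z.2 < m j := lt_of_le_of_ne (hzK.1 j) hj
      have h1 : Tendsto (fun ε : ℝ => p j * (z.1 + ε * e₁) + q j * (z.2 + ε * e₂)) (𝓝 0)
          (𝓝 (p j * (z.1 + 0 * e₁) + q j * (z.2 + 0 * e₂))) :=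
        Continuous.tendsto (by fun_prop) 0
      have h2 : Tendsto (fun ε : ℝ => p j * (z.1 - ε * e₁) + q j * (z.2 - ε * e₂)) (𝓝 0)
          (𝓝 (p j * (z.1 - 0 * e₁) + q j * (z.2 - 0 * e₂))) :=
        Continuous.tendsto (by fun_prop) 0
      filter_upwards [h1.eventually_lt_const (by simpa using hlt),
        h2.eventually_lt_const (by simpa using hlt)] with ε g1 g2
      exact ⟨g1.le, g2.le⟩
  obtain ⟨ε, hε, hε0⟩ := ((hev.filter_mono nhdsWithin_le_nhds).and
    (self_mem_nhdsWithin : Set.Ioi (0 : ℝ) ∈ 𝓝[>] 0)).exists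
  replace hε0 : 0 < ε := hε0
  have hseg := hzK.2 (x₁ := (z.1 + ε * e₁, z.2 + ε * e₂)) (fun j => (hε j).1)
    (x₂ := (z.1 - ε * e₁, z.2 - ε * e₂)) (fun j => (hε j).2)
    ⟨1 / 2, 1 / 2, by norm_num, by norm_num, by norm_num, by
      ext
      · simp; ring
      · simp; ring⟩
  have g1 := congrArg Prod.fst hseg
  have g2 := congrArg Prod.snd hseg
  simp only [add_eq_left, mul_eq_zero, hε0.ne', false_or] at g1 g2
  rcases he with h | h
  · exact h g1
  · exact h g2

/-- For a polygon with integral data the coordinates of the vertex are rational and the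
denominator is a minor of the system. -/
theorem exists_rational_vertex {ι : Type*} [Finite ι] {p q m : ι → ℤ} {R : ℝ}
    (hR : ∀ x y : ℝ, (∀ j, p j * x + q j * y ≤ m j) → |x| ≤ R ∧ |y| ≤ R) {x₀ y₀ : ℝ}
    (h₀ : ∀ j, p j * x₀ + q j * y₀ ≤ m j) (α β : ℝ) :
    ∃ N₁ N₂ D : ℤ, 0 < D ∧ (∃ j j', D = |p j * q j' - p j' * q j|) ∧
      (∀ j, p j * (N₁ / D : ℝ) + q j * (N₂ / D : ℝ) ≤ m j) ∧
      α * x₀ + β * y₀ ≤ α * (N₁ / D : ℝ) + β * (N₂ / D : ℝ) := by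
  obtain ⟨x, y, hf, hobj, j, j', hΔ, h1, h2⟩ := exists_vertex (p := fun j => (p j : ℝ))
    (q := fun j => (q j : ℝ)) (m := fun j => (m j : ℝ)) hR h₀ α β
  set Δ : ℤ := p j * q j' - p j' * q j with hΔd
  have hΔr : (Δ : ℝ) = p j * q j' - p j' * q j := by rw [hΔd]; push_cast; ring
  have hΔ0 : Δ ≠ 0 := by
    intro h
    apply hΔ
    rw [← hΔr, h, Int.cast_zero]
  obtain ⟨σ, hσ1, hσ2⟩ : ∃ σ : ℤ, |Δ| = σ * Δ ∧ (σ = 1 ∨ σ = -1) := by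
    rcases abs_choice Δ with h | h
    · exact ⟨1, by rw [h, one_mul], Or.inl rfl⟩
    · exact ⟨-1, by rw [h]; ring, Or.inr rfl⟩
  have hD : 0 < |Δ| := abs_pos.2 hΔ0
  have hDr : (|Δ| : ℤ) ≠ (0 : ℝ) := by exact_mod_cast hD.ne'
  have hDσ : ((|Δ| : ℤ) : ℝ) = σ * (p j * q j' - p j' * q j) := by
    rw [hσ1, Int.cast_mul, hΔr]
  have ex : ((σ * (m j * q j' - m j' * q j) : ℤ) : ℝ) / ((|Δ| : ℤ) : ℝ) = x := by
    rw [div_eq_iff hDr, hDσ]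
    push_cast
    linear_combination -σ * q j' * h1 + σ * q j * h2
  have ey : ((σ * (p j * m j' - p j' * m j) : ℤ) : ℝ) / ((|Δ| : ℤ) : ℝ) = y := by
    rw [div_eq_iff hDr, hDσ]
    push_cast
    linear_combination σ * p j' * h1 - σ * p j * h2
  refine ⟨σ * (m j * q j' - m j' * q j), σ * (p j * m j' - p j' * m j), |Δ|, hD, ⟨j, j', rfl⟩, ?_⟩
  rw [ex, ey]
  exact ⟨hf, hobj⟩

/-- Evaluating the rows (p, q), (p', q') at the basis multiplies their minor by the determinant up
to sign. The resulting minor has entries of size at most k, and the determinant is at least 1. This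
bounds the denominators of the vertices. -/
theorem abs_minor_le {a b c d k : ℝ} (hdet : 1 ≤ a * d + b * c) {p q p' q' : ℤ}
    (h1 : |p * a + q * c| ≤ k) (h2 : |p * b - q * d| ≤ k) (h3 : |p' * a + q' * c| ≤ k)
    (h4 : |p' * b - q' * d| ≤ k) : ((|p * q' - p' * q| : ℤ) : ℝ) ≤ 2 * k ^ 2 := by
  have key : ((p * q' - p' * q : ℤ) : ℝ) * (a * d + b * c) =
      (p' * a + q' * c) * (p * b - q * d) - (p * a + q * c) * (p' * b - q' * d) := by
    push_cast; ring
  have habs : |((p * q' - p' * q : ℤ) : ℝ)| * (a * d + b * c) ≤ 2 * k ^ 2 := by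
    rw [← abs_of_pos (lt_of_lt_of_le one_pos hdet), ← abs_mul, key]
    refine (abs_sub _ _).trans ?_
    rw [abs_mul, abs_mul]
    have g1 := mul_le_mul h3 h2 (abs_nonneg _) ((abs_nonneg _).trans h3)
    have g2 := mul_le_mul h1 h4 (abs_nonneg _) ((abs_nonneg _).trans h1)
    linarith
  rw [Int.cast_abs]
  nlinarith [abs_nonneg ((p * q' - p' * q : ℤ) : ℝ)]

theorem gen_le_gen {a b c d a' b' c' d' : ℝ} (hu : ![a', b'] ∈ gen a b c d)
    (hv : ![c', -d'] ∈ gen a b c d) : gen a' b' c' d' ≤ gen a b c d := by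
  rw [gen, Submodule.span_le]
  rintro p (rfl | rfl)
  · exact hu
  · exact hv

/-- Every piercing lattice is dominated by one with rational coordinates of small height. -/
theorem exists_rational_lattice {n : ℕ} (hn : 0 < n) {w h : Fin n → ℕ} (hw : ∀ i, 1 ≤ w i)
    (hh : ∀ i, 1 ≤ h i) {k : ℕ} (hwk : ∀ i, w i ≤ k) (hhk : ∀ i, h i ≤ k)
    {L : Submodule ℤ Plane} (hL : IsLattice L) (hP : ∀ i, Pierces (w i) (h i) L) :
    ∃ D₁ D₂ A B C D : ℤ, 1 ≤ D₁ ∧ D₁ ≤ 2 * k ^ 2 ∧ 1 ≤ D₂ ∧ D₂ ≤ 2 * k ^ 2 ∧ 0 ≤ A ∧ 0 ≤ B ∧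
      0 ≤ C ∧ 0 ≤ D ∧ (∀ i, A + C ≤ w i * D₁) ∧ B ≤ k * D₂ ∧ D ≤ k * D₂ ∧
      D₁ * D₂ ≤ A * D + B * C ∧
      ZLattice.covolume L ≤ ((A * D + B * C : ℤ) : ℝ) / ((D₁ * D₂ : ℤ) : ℝ) ∧
      ∀ i, Pierces (w i) (h i) (gen (A / D₁) (B / D₂) (C / D₁) (D / D₂)) := by
  have hk : 1 ≤ k := (hw ⟨0, hn⟩).trans (hwk _)
  rcases lt_or_ge (ZLattice.covolume L) 1 with hcov | hcov
  · have hk2 : (1 : ℤ) ≤ 2 * k ^ 2 := by exact_mod_cast (by nlinarith : 1 ≤ 2 * k ^ 2)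
    refine ⟨1, 1, 1, 0, 0, 1, le_rfl, hk2, le_rfl, hk2, by simp, by simp, by simp, by simp, ?_,
      by simp, by simpa using hk, by simp, by simpa using hcov.le, ?_⟩
    · intro i
      simpa using hw i
    · intro i
      refine gen_pierces (by simp) (by simp) (by simp) (by simp) (by simp) ?_ (by simp) ?_
      · simpa using hw i
      · simpa using hh i
  have hex := fun i => exists_basis_of_pierces hL (Nat.cast_pos.2 (hh i)) (hP i)
  choose a b c d ha hb hc hd hdet hLgen haw hbh hdh using hex
  have : Nonempty (Fin n) := ⟨⟨0, hn⟩⟩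
  -- The reference basis belongs to a narrowest rectangle, so that the new a + c stays below every
  -- width, as the walk requires of its starting basis.
  obtain ⟨o, ho⟩ := Finite.exists_min w
  -- The coefficients for `o` are those of the identity: the constraints of `o` then bound the
  -- polygons and keep the new coordinates nonnegative.
  have hcoef : ∀ i, ∃ α β γ δ : ℤ, a i = α * a o + β * c o ∧ b i = α * b o - β * d o ∧
      c i = γ * a o + δ * c o ∧ -d i = γ * b o - δ * d o ∧
      (i = o → α = 1 ∧ β = 0 ∧ γ = 0 ∧ δ = 1) := by
    intro i
    by_cases hi : i = o
    · subst hi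
      exact ⟨1, 0, 0, 1, by simp, by simp, by simp, by simp, by simp⟩
    · have h1 : ![a i, b i] ∈ gen (a o) (b o) (c o) (d o) := by
        rw [← hLgen o, hLgen i]
        exact Submodule.subset_span (by simp)
      have h2 : ![c i, -d i] ∈ gen (a o) (b o) (c o) (d o) := by
        rw [← hLgen o, hLgen i]
        exact Submodule.subset_span (by simp)
      obtain ⟨α, β, e1, e2⟩ := mem_gen.1 h1
      obtain ⟨γ, δ, e3, e4⟩ := mem_gen.1 h2
      exact ⟨α, β, γ, δ, e1, e2, e3, e4, fun h => absurd h hi⟩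
  choose α β γ δ e1 e2 e3 e4 e5 using hcoef
  obtain ⟨o1, o2, o3, o4⟩ := e5 o rfl
  have hcovL : ZLattice.covolume L = a o * d o + b o * c o := by
    rw [hLgen o, covolume_gen (hdet o)]
  rw [hcovL] at hcov
  have hdetA : ∀ i, 0 < α i * δ i - β i * γ i := by
    intro i
    have key : ((α i * δ i - β i * γ i : ℤ) : ℝ) * (a o * d o + b o * c o) =
        a i * d i + b i * c i := by
      push_cast
      linear_combination (-d i) * e1 i - (c i) * e2 i +
        (-α i * b o + β i * d o) * e3 i + (α i * a o + β i * c o) * e4 i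
    have := hdet i
    rw [← key] at this
    exact_mod_cast (pos_iff_pos_of_mul_pos this).2 (hdet o)
  have hwk' : ∀ i, (w i : ℝ) ≤ k := fun i => by exact_mod_cast hwk i
  have hhk' : ∀ i, (h i : ℝ) ≤ k := fun i => by exact_mod_cast hhk i
  -- the polygon of the `x`-coordinates
  obtain ⟨A, C, D₁, hD₁, ⟨⟨i, s⟩, ⟨i', s'⟩, hm₁⟩, hx, hobj₁⟩ := exists_rational_vertex
    (ι := Fin n × Fin 3)
    (p := fun z => ![-α z.1, -γ z.1, α z.1 + γ z.1] z.2)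
    (q := fun z => ![-β z.1, -δ z.1, β z.1 + δ z.1] z.2)
    (m := fun z => ![0, 0, (w z.1 : ℤ)] z.2) (R := w o) (x₀ := a o) (y₀ := c o)
    (by
      intro x y H
      have h0 := H (o, 0)
      have h1 := H (o, 1)
      have h2 := H (o, 2)
      simp [o1, o2, o3, o4] at h0 h1 h2
      constructor <;> rw [abs_le] <;> constructor <;> linarith)
    (by
      rintro ⟨i, s⟩
      fin_cases s
      · have := ha i
        simp; linarith [e1 i]
      · have := hc i
        simp; linarith [e3 i]
      · have := haw i
        simp; linarith [e1 i, e3 i]) (d o) (b o)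
  have hbound₁ : D₁ ≤ 2 * k ^ 2 := by
    have hN : ∀ z : Fin n × Fin 3,
        |((![-α z.1, -γ z.1, α z.1 + γ z.1] z.2 : ℤ) : ℝ) * a o +
          ((![-β z.1, -δ z.1, β z.1 + δ z.1] z.2 : ℤ) : ℝ) * c o| ≤ k ∧
        |((![-α z.1, -γ z.1, α z.1 + γ z.1] z.2 : ℤ) : ℝ) * b o -
          ((![-β z.1, -δ z.1, β z.1 + δ z.1] z.2 : ℤ) : ℝ) * d o| ≤ k := by
      rintro ⟨i, s⟩
      have := ha i; have := hb i; have := hc i; have := hd i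
      have := haw i; have := hbh i; have := hdh i
      have := hwk' i; have := hhk' i
      have := e1 i; have := e2 i; have := e3 i; have := e4 i
      constructor <;> rw [abs_le] <;> fin_cases s <;> simp <;> constructor <;> linarith
    have := abs_minor_le hcov (hN (i, s)).1 (hN (i, s)).2 (hN (i', s')).1 (hN (i', s')).2
    rw [← hm₁] at this
    exact_mod_cast this
  set a' : ℝ := A / D₁ with ha'
  set c' : ℝ := C / D₁ with hc'
  -- the polygon of the `y`-coordinates
  obtain ⟨B, D, D₂, hD₂, ⟨⟨j, t⟩, ⟨j', t'⟩, hm₂⟩, hy, hobj₂⟩ := exists_rational_vertex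
    (ι := Fin n × Fin 4)
    (p := fun z => ![-α z.1, γ z.1, α z.1, -γ z.1] z.2)
    (q := fun z => ![β z.1, -δ z.1, -β z.1, δ z.1] z.2)
    (m := fun z => ![0, 0, (h z.1 : ℤ), (h z.1 : ℤ)] z.2) (R := h o) (x₀ := b o) (y₀ := d o)
    (by
      intro x y H
      have h0 := H (o, 0)
      have h1 := H (o, 1)
      have h2 := H (o, 2)
      have h3 := H (o, 3)
      simp [o1, o2, o3, o4] at h0 h1 h2 h3
      constructor <;> rw [abs_le] <;> constructor <;> linarith)
    (by
      rintro ⟨i, s⟩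
      have := hb i
      have := hd i
      have := hbh i
      have := hdh i
      have := e2 i; have := e4 i
      fin_cases s <;> simp <;> linarith) c' a'
  have hbound₂ : D₂ ≤ 2 * k ^ 2 := by
    have hN : ∀ z : Fin n × Fin 4,
        |((![-α z.1, γ z.1, α z.1, -γ z.1] z.2 : ℤ) : ℝ) * b o +
          ((![β z.1, -δ z.1, -β z.1, δ z.1] z.2 : ℤ) : ℝ) * d o| ≤ k ∧
        |((![-α z.1, γ z.1, α z.1, -γ z.1] z.2 : ℤ) : ℝ) * a o -
          ((![β z.1, -δ z.1, -β z.1, δ z.1] z.2 : ℤ) : ℝ) * c o| ≤ k := by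
      rintro ⟨i, s⟩
      have := ha i; have := hb i; have := hc i; have := hd i
      have := haw i; have := hbh i; have := hdh i
      have := hwk' i; have := hhk' i
      have := e1 i; have := e2 i; have := e3 i; have := e4 i
      constructor <;> rw [abs_le] <;> fin_cases s <;> simp <;> constructor <;> linarith
    have := abs_minor_le (a := b o) (b := a o) (c := d o) (d := c o) (by linarith)
      (hN (j, t)).1 (hN (j, t)).2 (hN (j', t')).1 (hN (j', t')).2
    rw [← hm₂] at this
    exact_mod_cast this
  set b' : ℝ := B / D₂ with hb'
  set d' : ℝ := D / D₂ with hd'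
  have hD₁r : (0 : ℝ) < D₁ := by exact_mod_cast hD₁
  have hD₂r : (0 : ℝ) < D₂ := by exact_mod_cast hD₂
  -- The first objective was the determinant with the old (b, d), the second one the determinant
  -- with the new (a, c).
  have hdet' : a o * d o + b o * c o ≤ a' * d' + b' * c' := by linarith
  have hdetpos : 0 < a' * d' + b' * c' := (hdet o).trans_le hdet'
  have hval : ((A * D + B * C : ℤ) : ℝ) / ((D₁ * D₂ : ℤ) : ℝ) = a' * d' + b' * c' := by
    rw [ha', hb', hc', hd']
    push_cast
    field_simp
  have hx' : ∀ i, 0 ≤ α i * a' + β i * c' ∧ 0 ≤ γ i * a' + δ i * c' ∧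
      (α i * a' + β i * c') + (γ i * a' + δ i * c') ≤ w i := by
    intro i
    have h0 := hx (i, 0)
    have h1 := hx (i, 1)
    have h2 := hx (i, 2)
    simp at h0 h1 h2
    exact ⟨by linarith, by linarith, by linarith⟩
  have hy' : ∀ i, 0 ≤ α i * b' - β i * d' ∧ 0 ≤ -γ i * b' + δ i * d' ∧
      α i * b' - β i * d' ≤ h i ∧ -γ i * b' + δ i * d' ≤ h i := by
    intro i
    have h0 := hy (i, 0)
    have h1 := hy (i, 1)
    have h2 := hy (i, 2)
    have h3 := hy (i, 3)
    simp at h0 h1 h2 h3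
    exact ⟨by linarith, by linarith, by linarith, by linarith⟩
  obtain ⟨x1, x2, x3⟩ := hx' o
  obtain ⟨y1, y2, y3, y4⟩ := hy' o
  simp only [o1, o2, o3, o4, Int.cast_one, Int.cast_zero, one_mul, zero_mul, add_zero, zero_add, sub_zero,
    neg_zero] at x1 x2 x3 y1 y2 y3 y4
  refine ⟨D₁, D₂, A, B, C, D, hD₁, hbound₁, hD₂, hbound₂, ?_, ?_, ?_, ?_, ?_, ?_, ?_, ?_, ?_, ?_⟩
  · rw [ha', le_div_iff₀ hD₁r, zero_mul] at x1
    exact_mod_cast x1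
  · rw [hb', le_div_iff₀ hD₂r, zero_mul] at y1
    exact_mod_cast y1
  · rw [hc', le_div_iff₀ hD₁r, zero_mul] at x2
    exact_mod_cast x2
  · rw [hd', le_div_iff₀ hD₂r, zero_mul] at y2
    exact_mod_cast y2
  · intro i
    have h1 : a' + c' ≤ w i := x3.trans (by exact_mod_cast ho i)
    rw [ha', hc', ← add_div, div_le_iff₀ hD₁r] at h1
    exact_mod_cast h1
  · have h1 : b' ≤ k := y3.trans (hhk' o)
    rw [hb', div_le_iff₀ hD₂r] at h1
    exact_mod_cast h1
  · have h1 : d' ≤ k := y4.trans (hhk' o)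
    rw [hd', div_le_iff₀ hD₂r] at h1
    exact_mod_cast h1
  · have h1 : (1 : ℝ) ≤ ((A * D + B * C : ℤ) : ℝ) / ((D₁ * D₂ : ℤ) : ℝ) := by
      rw [hval]; linarith
    rw [le_div_iff₀ (by push_cast; positivity), one_mul] at h1
    exact_mod_cast h1
  · rw [hval, hcovL]
    exact hdet'
  · intro i
    obtain ⟨g1, g2, g3⟩ := hx' i
    obtain ⟨g4, g5, g6, g7⟩ := hy' i
    -- The frozen combinations of the new vectors are still short. That the group they generate lies
    -- in the new lattice is enough.
    refine (gen_pierces g1 g4 g2 g5 ?_ g3 g6 g7).mono (gen_le_gen ?_ ?_)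
    · have : (0 : ℝ) < α i * δ i - β i * γ i := by exact_mod_cast hdetA i
      have := mul_pos this hdetpos
      linarith
    · exact mem_gen.2 ⟨α i, β i, by simp [ha', hc'], by simp [hb', hd']⟩
    · exact mem_gen.2 ⟨γ i, δ i, by simp [ha', hc'], by simp [hb', hd']; ring⟩

/-! ### The Euclidean walk through the bases of a lattice -/

/-- The integers `a, b, c, d` stand for the pair of vectors `(a, b)`, `(c, -d)`. -/
@[ext]
structure Coords : Type where
  a : ℤ
  b : ℤ
  c : ℤ
  d : ℤ

namespace Coords

/-- Both vectors lie in the right quadrants. -/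
structure Nonneg (s : Coords) : Prop where
  a : 0 ≤ s.a
  b : 0 ≤ s.b
  c : 0 ≤ s.c
  d : 0 ≤ s.d

/-- The determinant, up to sign. -/
def det (s : Coords) : ℤ := s.a * s.d + s.b * s.c

/-- The lattice of the pair, where the two axes are scaled by `1 / D₁` and `1 / D₂`. -/
noncomputable def lattice (D₁ D₂ : ℤ) (s : Coords) : Submodule ℤ Plane :=
  gen (s.a / D₁) (s.b / D₂) (s.c / D₁) (s.d / D₂)

/-- The pair certifies that the `W × H` rectangle is pierced. -/
def Short (W H : ℤ) (s : Coords) : Prop := s.a + s.c ≤ W ∧ s.b ≤ H ∧ s.d ≤ H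

/-- Replace the steeper vector by the sum of the two, as long as this may help to pierce the
`W × H` rectangle. -/
def step (W H : ℤ) (s : Coords) : Coords :=
  if s.a + s.c ≤ W then
    if s.d < s.b then
      if H < s.b then ⟨s.a + s.c, s.b - s.d, s.c, s.d⟩ else s
    else if H < s.d then ⟨s.a, s.b, s.c + s.a, s.d - s.b⟩ else s
  else s

theorem step_cases {motive : Coords → Prop} (W H : ℤ) (s : Coords) (h0 : motive s)
    (h1 : s.a + s.c ≤ W → s.d < s.b → H < s.b → motive ⟨s.a + s.c, s.b - s.d, s.c, s.d⟩)
    (h2 : s.a + s.c ≤ W → s.b ≤ s.d → H < s.d → motive ⟨s.a, s.b, s.c + s.a, s.d - s.b⟩) :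
    motive (step W H s) := by
  unfold step
  split_ifs with g1 g2 g3 g3
  · exact h1 g1 g2 g3
  · exact h0
  · exact h2 g1 (not_lt.1 g2) g3
  · exact h0
  · exact h0

theorem Nonneg.step {s : Coords} (hs : s.Nonneg) (W H : ℤ) : (step W H s).Nonneg := by
  obtain ⟨ha, hb, hc, hd⟩ := hs
  refine step_cases W H s ⟨ha, hb, hc, hd⟩ (fun _ h _ => ⟨?_, ?_, ?_, ?_⟩)
    (fun _ h _ => ⟨?_, ?_, ?_, ?_⟩) <;> simp only <;> omega

theorem det_step (W H : ℤ) (s : Coords) : (step W H s).det = s.det := by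
  refine step_cases (motive := fun t => t.det = s.det) W H s rfl (fun _ _ _ => ?_)
    (fun _ _ _ => ?_) <;> simp only [det] <;> ring

theorem lattice_step_le (D₁ D₂ W H : ℤ) (s : Coords) :
    (step W H s).lattice D₁ D₂ ≤ s.lattice D₁ D₂ := by
  refine step_cases (motive := fun t => t.lattice D₁ D₂ ≤ s.lattice D₁ D₂) W H s le_rfl
    (fun _ _ _ => ?_) (fun _ _ _ => ?_)
  · exact gen_le_gen (mem_gen.2 ⟨1, 1, by simp; ring, by simp; ring⟩)
      (mem_gen.2 ⟨0, 1, by simp, by simp⟩)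
  · exact gen_le_gen (mem_gen.2 ⟨1, 0, by simp, by simp⟩)
      (mem_gen.2 ⟨1, 1, by simp; ring, by simp; ring⟩)

theorem le_lattice_step (D₁ D₂ W H : ℤ) (s : Coords) :
    s.lattice D₁ D₂ ≤ (step W H s).lattice D₁ D₂ := by
  refine step_cases (motive := fun t => s.lattice D₁ D₂ ≤ t.lattice D₁ D₂) W H s le_rfl
    (fun _ _ _ => ?_) (fun _ _ _ => ?_)
  · exact gen_le_gen (mem_gen.2 ⟨1, -1, by simp; ring, by simp; ring⟩)
      (mem_gen.2 ⟨0, 1, by simp, by simp⟩)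
  · exact gen_le_gen (mem_gen.2 ⟨1, 0, by simp, by simp⟩)
      (mem_gen.2 ⟨-1, 1, by simp; ring, by simp; ring⟩)

theorem lattice_step (D₁ D₂ W H : ℤ) (s : Coords) :
    (step W H s).lattice D₁ D₂ = s.lattice D₁ D₂ :=
  le_antisymm (lattice_step_le D₁ D₂ W H s) (le_lattice_step D₁ D₂ W H s)

theorem Nonneg.iterate {s : Coords} (hs : s.Nonneg) (W H : ℤ) (m : ℕ) :
    ((Coords.step W H)^[m] s).Nonneg := by
  induction m with
  | zero => exact hs
  | succ m ih => rw [Function.iterate_succ_apply']; exact ih.step W H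

theorem det_iterate (W H : ℤ) (s : Coords) (m : ℕ) : ((step W H)^[m] s).det = s.det := by
  induction m with
  | zero => rfl
  | succ m ih => rw [Function.iterate_succ_apply', det_step, ih]

theorem lattice_iterate (D₁ D₂ W H : ℤ) (s : Coords) (m : ℕ) :
    ((step W H)^[m] s).lattice D₁ D₂ = s.lattice D₁ D₂ := by
  induction m with
  | zero => rfl
  | succ m ih => rw [Function.iterate_succ_apply', lattice_step, ih]

/-- All coordinates are bounded. -/
structure Bounded (X Y : ℤ) (s : Coords) : Prop where
  a : s.a ≤ X
  b : s.b ≤ Y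
  c : s.c ≤ X
  d : s.d ≤ Y

/-- The abscissas grow only under the guard a + c ≤ W, and the heights never grow. Hence the walk
never needs longer words. -/
theorem Bounded.step {X Y W H : ℤ} (hWX : W ≤ X) {s : Coords} (hs : s.Nonneg)
    (hb : s.Bounded X Y) : (step W H s).Bounded X Y := by
  obtain ⟨ha, hb, hc, hd⟩ := hb
  obtain ⟨ha', hb', hc', hd'⟩ := hs
  refine step_cases W H s ⟨ha, hb, hc, hd⟩ (fun _ _ _ => ⟨?_, ?_, ?_, ?_⟩)
    (fun _ _ _ => ⟨?_, ?_, ?_, ?_⟩) <;> simp only <;> omega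

theorem Bounded.iterate {X Y W H : ℤ} (hWX : W ≤ X) {s : Coords} (hs : s.Nonneg)
    (hb : s.Bounded X Y) (m : ℕ) : ((Coords.step W H)^[m] s).Bounded X Y := by
  induction m with
  | zero => exact hb
  | succ m ih => rw [Function.iterate_succ_apply']; exact ih.step hWX (hs.iterate W H m)

/-- After `m` steps the pair is a certificate. -/
def Accepts (m : ℕ) (W H : ℤ) (s : Coords) : Prop := Short W H ((step W H)^[m] s)

theorem div_det {D₁ D₂ : ℤ} (s : Coords) :
    ((s.a / D₁ : ℝ) * (s.d / D₂) + (s.b / D₂) * (s.c / D₁)) = s.det / (D₁ * D₂ : ℝ) := by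
  rw [det]
  push_cast
  ring

/-- Soundness of the test: the walk preserves the lattice, the determinant and the signs, so a short
basis met at any time proves piercing. -/
theorem Accepts.pierces {m : ℕ} {w h : ℕ} {D₁ D₂ : ℤ} (h₁ : 0 < D₁) (h₂ : 0 < D₂) {s : Coords}
    (hs : s.Nonneg) (hdet : 0 < s.det) (hacc : s.Accepts m (w * D₁) (h * D₂)) :
    Pierces w h (s.lattice D₁ D₂) := by
  have h₁' : (0 : ℝ) < D₁ := by exact_mod_cast h₁
  have h₂' : (0 : ℝ) < D₂ := by exact_mod_cast h₂
  rw [← lattice_iterate D₁ D₂ (w * D₁) (h * D₂) s m]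
  rw [← det_iterate (w * D₁) (h * D₂) s m] at hdet
  obtain ⟨ha, hb, hc, hd⟩ := hs.iterate (w * D₁) (h * D₂) m
  obtain ⟨h1, h2, h3⟩ := hacc
  set r := (step (w * D₁) (h * D₂))^[m] s
  refine gen_pierces ?_ ?_ ?_ ?_ ?_ ?_ ?_ ?_
  · have : (0 : ℝ) ≤ r.a := by exact_mod_cast ha
    positivity
  · have : (0 : ℝ) ≤ r.b := by exact_mod_cast hb
    positivity
  · have : (0 : ℝ) ≤ r.c := by exact_mod_cast hc
    positivity
  · have : (0 : ℝ) ≤ r.d := by exact_mod_cast hd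
    positivity
  · rw [div_det]
    have : (0 : ℝ) < r.det := by exact_mod_cast hdet
    positivity
  · rw [← add_div, div_le_iff₀ h₁']
    exact_mod_cast h1
  · rw [div_le_iff₀ h₂']
    exact_mod_cast h2
  · rw [div_le_iff₀ h₂']
    exact_mod_cast h3

/-- The situation in which the walk succeeds. -/
structure Pierced (k w h : ℕ) (D₁ D₂ : ℤ) (s : Coords) : Prop where
  nonneg : s.Nonneg
  det : D₁ * D₂ ≤ s.det
  pierces : Pierces w h (s.lattice D₁ D₂)
  width : s.a + s.c ≤ w * D₁
  b : s.b ≤ k * D₂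
  d : s.d ≤ k * D₂

/-- The decreasing quantity. -/
def potential (D₁ D₂ W : ℤ) (s : Coords) : ℤ := D₂ * (W - (s.a + s.c)) + D₁ * (s.b + s.d)

theorem Nonneg.le_or_le {s : Coords} (hs : s.Nonneg) {w h : ℕ} {D₁ D₂ : ℤ} (h₁ : 0 < D₁)
    (h₂ : 0 < D₂) (hP : Pierces w h (s.lattice D₁ D₂)) :
    s.a + s.c ≤ w * D₁ ∨ s.b + s.d ≤ h * D₂ := by
  have h₁' : (0 : ℝ) < D₁ := by exact_mod_cast h₁
  have h₂' : (0 : ℝ) < D₂ := by exact_mod_cast h₂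
  have ha : (0 : ℝ) ≤ s.a := by exact_mod_cast hs.a
  have hb : (0 : ℝ) ≤ s.b := by exact_mod_cast hs.b
  have hc : (0 : ℝ) ≤ s.c := by exact_mod_cast hs.c
  have hd : (0 : ℝ) ≤ s.d := by exact_mod_cast hs.d
  have := Pierces.le_or_le (by positivity) (by positivity) (by positivity) (by positivity) hP
  rw [← add_div, ← add_div, div_le_iff₀ h₁', div_le_iff₀ h₂'] at this
  exact_mod_cast this

/-- The delicate invariant is the width. A move leaves a pair whose heights sum to the height of the
replaced vector, which exceeds H; since the lattice pierces, `Nonneg.le_or_le` then bounds the new a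
+ c by W. -/
theorem Pierced.step {k w h : ℕ} {D₁ D₂ : ℤ} (h₁ : 0 < D₁) (h₂ : 0 < D₂) {s : Coords}
    (hs : s.Pierced k w h D₁ D₂) : (step (w * D₁) (h * D₂) s).Pierced k w h D₁ D₂ := by
  have hn := hs.nonneg.step (w * D₁) (h * D₂)
  have hp : Pierces w h ((Coords.step (w * D₁) (h * D₂) s).lattice D₁ D₂) := by
    rw [lattice_step]; exact hs.pierces
  have hor := hn.le_or_le h₁ h₂ hp
  obtain ⟨⟨ha, hb, hc, hd⟩, hdet, -, hw, hbk, hdk⟩ := hs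
  refine ⟨hn, by rw [det_step]; exact hdet, hp, ?_, ?_, ?_⟩
  · revert hor
    refine step_cases (motive := fun t => t.a + t.c ≤ w * D₁ ∨ t.b + t.d ≤ h * D₂ →
      t.a + t.c ≤ w * D₁) _ _ s (fun _ => hw) (fun g1 g2 g3 => ?_) (fun g1 g2 g3 => ?_) <;> simp only <;> omega
  · refine step_cases (motive := fun t => t.b ≤ k * D₂) _ _ s hbk
      (fun g1 g2 g3 => ?_) (fun g1 g2 g3 => ?_) <;> simp only <;> omega
  · refine step_cases (motive := fun t => t.d ≤ k * D₂) _ _ s hdk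
      (fun g1 g2 g3 => ?_) (fun g1 g2 g3 => ?_) <;> simp only <;> omega

theorem Pierced.iterate {k w h : ℕ} {D₁ D₂ : ℤ} (h₁ : 0 < D₁) (h₂ : 0 < D₂) {s : Coords}
    (hs : s.Pierced k w h D₁ D₂) (m : ℕ) :
    ((Coords.step (w * D₁) (h * D₂))^[m] s).Pierced k w h D₁ D₂ := by
  induction m with
  | zero => exact hs
  | succ m ih => rw [Function.iterate_succ_apply']; exact ih.step h₁ h₂

/-- Certificates are fixed points, so the walk may always run for a fixed number of rounds. -/
theorem Short.step {W H : ℤ} {s : Coords} (hs : s.Short W H) : step W H s = s := by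
  obtain ⟨h1, h2, h3⟩ := hs
  unfold Coords.step
  rw [if_pos h1, if_neg (not_lt.2 h2), if_neg (not_lt.2 h3), ite_self]

/-- A move lowers the potential by D₂c + D₁d or by D₂a + D₁b. As a, c ≤ kD₁ and b, d ≤ kD₂, k times
either amount is at least ad + bc, hence at least D₁D₂. -/
theorem Pierced.potential_step {k w h : ℕ} {D₁ D₂ : ℤ} (h₁ : 0 < D₁)
    (hwk : w ≤ k) {s : Coords} (hs : s.Pierced k w h D₁ D₂) (hsh : ¬ s.Short (w * D₁) (h * D₂)) :
    k * (Coords.step (w * D₁) (h * D₂) s).potential D₁ D₂ (w * D₁) + D₁ * D₂ ≤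
      k * s.potential D₁ D₂ (w * D₁) := by
  obtain ⟨⟨ha, hb, hc, hd⟩, hdet, -, hw, hbk, hdk⟩ := hs
  have hwk' : (w : ℤ) * D₁ ≤ k * D₁ := mul_le_mul_of_nonneg_right (by exact_mod_cast hwk) h₁.le
  have hak : s.a ≤ k * D₁ := by omega
  have hck : s.c ≤ k * D₁ := by omega
  rw [Coords.det] at hdet
  have e1 := mul_le_mul_of_nonneg_right hak hd
  have e2 := mul_le_mul_of_nonneg_right hbk hc
  have e3 := mul_le_mul_of_nonneg_right hck hb
  have e4 := mul_le_mul_of_nonneg_right hdk ha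
  unfold Coords.step
  rw [if_pos hw]
  split_ifs with g1 g2 g2
  · simp only [potential]; linarith
  · exact absurd ⟨hw, not_lt.1 g2, by omega⟩ hsh
  · simp only [potential]; linarith
  · exact absurd ⟨hw, by omega, not_lt.1 g2⟩ hsh

/-- Completeness of the test: k times the potential starts at no more than 3k²D₁D₂, stays
nonnegative and drops by D₁D₂ in every round before a certificate is reached. -/
theorem Pierced.accepts {k w h : ℕ} {D₁ D₂ : ℤ} (h₁ : 0 < D₁) (h₂ : 0 < D₂) (hwk : w ≤ k)
    {s : Coords} (hs : s.Pierced k w h D₁ D₂) :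
    s.Accepts (3 * k ^ 2 + 1) (w * D₁) (h * D₂) := by
  have key : ∀ m : ℕ, ¬ s.Accepts m (w * D₁) (h * D₂) →
      k * ((Coords.step (w * D₁) (h * D₂))^[m] s).potential D₁ D₂ (w * D₁) + m * (D₁ * D₂) ≤
        k * s.potential D₁ D₂ (w * D₁) := by
    intro m
    induction m with
    | zero => intro _; simp
    | succ m ih =>
      intro hm
      have hm' : ¬ s.Accepts m (w * D₁) (h * D₂) := by
        intro hacc
        apply hm
        rw [Accepts, Function.iterate_succ_apply', Short.step hacc]
        exact hacc
      have h3 := ih hm'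
      have h4 := (hs.iterate h₁ h₂ m).potential_step h₁ hwk hm'
      rw [Function.iterate_succ_apply']
      push_cast
      linarith
  by_contra hcon
  have h3 := key _ hcon
  obtain ⟨⟨ha, hb, hc, hd⟩, -, -, hw, -, -⟩ := hs.iterate h₁ h₂ (3 * k ^ 2 + 1)
  have h4 : 0 ≤ ((Coords.step (w * D₁) (h * D₂))^[3 * k ^ 2 + 1] s).potential D₁ D₂ (w * D₁) :=
    add_nonneg (mul_nonneg h₂.le (by linarith)) (mul_nonneg h₁.le (by linarith))
  have h5 : s.potential D₁ D₂ (w * D₁) ≤ 3 * k * (D₁ * D₂) := by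
    have hwk' : (w : ℤ) * D₁ ≤ k * D₁ := mul_le_mul_of_nonneg_right (by exact_mod_cast hwk) h₁.le
    have e1 : D₂ * (w * D₁ - (s.a + s.c)) ≤ D₂ * (k * D₁) :=
      mul_le_mul_of_nonneg_left (by linarith [hs.nonneg.a, hs.nonneg.c]) h₂.le
    have e2 : D₁ * (s.b + s.d) ≤ D₁ * (2 * (k * D₂)) :=
      mul_le_mul_of_nonneg_left (by linarith [hs.b, hs.d]) h₁.le
    rw [potential]
    linarith
  have h6 := mul_le_mul_of_nonneg_left h5 (Int.natCast_nonneg k)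
  have h7 := mul_nonneg (Int.natCast_nonneg k) h4
  have h8 := mul_pos h₁ h₂
  push_cast at h3
  nlinarith

end Coords

end Piercing

/-! ### Rules for proving termination, running time and results of programs -/

namespace RAM

/-- The program halts, and its running time and the final memory satisfy `Q`. -/
def Halts (B : ℕ) (p : Program) (M : Memory) (Q : ℕ → Memory → Prop) : Prop :=
  ∃ t M', Runs B p M t M' ∧ Q t M'

variable {B : ℕ} {p q : Program} {M : Memory} {Q : ℕ → Memory → Prop} {d x y : ℤ}

theorem Halts.mono {Q' : ℕ → Memory → Prop} (h : Halts B p M Q) (hQ : ∀ t M', Q t M' → Q' t M') :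
    Halts B p M Q' :=
  let ⟨t, M', hr, h'⟩ := h
  ⟨t, M', hr, hQ t M' h'⟩

theorem halts_skip (h : Q 1 M) : Halts B .skip M Q := ⟨1, M, .skip M, h⟩

theorem halts_const {c : ℤ} (hB : |c| ≤ (B : ℤ)) (h : Q 1 (Function.update M d c)) :
    Halts B (.const d c) M Q := ⟨1, _, .const M d c hB, h⟩

/-- The result is a separate argument so that the memory records it in closed form, not as an
expression in earlier memories. -/
theorem halts_op {o : Op} (v : ℤ) (hv : o.eval (M x) (M y) = v) (hB : |v| ≤ (B : ℤ))
    (h : Q 1 (Function.update M d v)) : Halts B (.op o d x y) M Q := by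
  subst hv
  exact ⟨1, _, .op M o d x y hB, h⟩

theorem halts_load (v : ℤ) (hv : M (M x) = v) (hB : |v| ≤ (B : ℤ))
    (h : Q 1 (Function.update M d v)) : Halts B (.load d x) M Q := by
  subst hv
  exact ⟨1, _, .load M d x hB, h⟩

theorem halts_seq (h : Halts B p M fun s M' => Halts B q M' fun t M'' => Q (s + t) M'') :
    Halts B (.seq p q) M Q :=
  let ⟨s, _, hr, t, M'', hr', h'⟩ := h
  ⟨s + t, M'', .seq hr hr', h'⟩

theorem halts_ifPos (v : ℤ) (hv : M x = v) (hp : 0 < v → Halts B p M fun t M' => Q (t + 1) M')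
    (hq : v ≤ 0 → Halts B q M fun t M' => Q (t + 1) M') : Halts B (.ifPos x p q) M Q := by
  subst hv
  rcases lt_or_ge 0 (M x) with h | h
  · obtain ⟨t, M', hr, h'⟩ := hp h
    exact ⟨t + 1, M', .if_pos h hr, h'⟩
  · obtain ⟨t, M', hr, h'⟩ := hq h
    exact ⟨t + 1, M', .if_neg (not_lt.2 h) hr, h'⟩

/-- A loop whose counter `x` decreases by one in every round. -/
theorem halts_loop {T : ℕ} (I : ℕ → Memory → Prop) (hx : ∀ m M, I m M → M x = m)
    (hbody : ∀ m M, I (m + 1) M → Halts B p M fun t M' => t ≤ T ∧ I m M') :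
    ∀ m M, I m M → Halts B (.whilePos x p) M fun t M' => t ≤ m * (T + 1) + 1 ∧ I 0 M' := by
  intro m
  induction m with
  | zero =>
    intro M hM
    exact ⟨1, M, .while_neg (by rw [hx 0 M hM]; simp), by simp, hM⟩
  | succ m ih =>
    intro M hM
    obtain ⟨s, M', hr, hs, hM'⟩ := hbody m M hM
    obtain ⟨t, M'', hr', ht, hM''⟩ := ih M' hM'
    refine ⟨s + t + 1, M'', .while_pos (by rw [hx _ M hM]; positivity) hr hr', ?_, hM''⟩
    rw [add_mul]
    omega

end RAM

/-! ### The walk and the final test as programs -/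

namespace Piercing

open RAM

/-- One step of the walk. The cells `-31, …, -34` hold the coordinates, `-28` and `-29` the size
of the rectangle, `-2` the number one; `-35` and `-36` are scratch. -/
def stepProgram : Program :=
  .seq (.op .add (-35) (-31) (-33)) <|
  .seq (.op .sub (-35) (-28) (-35)) <|
  -- Tests are for strict positivity; adding one makes this one say a + c ≤ W.
  .seq (.op .add (-35) (-35) (-2)) <|
  .ifPos (-35)
    (.seq (.op .sub (-36) (-32) (-34)) <|
      .ifPos (-36)
        (.seq (.op .sub (-36) (-32) (-29)) <|
          .ifPos (-36)
            (.seq (.op .add (-31) (-31) (-33)) (.op .sub (-32) (-32) (-34))) .skip)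
        (.seq (.op .sub (-36) (-34) (-29)) <|
          .ifPos (-36)
            (.seq (.op .add (-33) (-33) (-31)) (.op .sub (-34) (-34) (-32))) .skip))
    .skip

/-- The coordinates are in the four cells below `r`. -/
structure Stores (M : Memory) (r : ℤ) (s : Coords) : Prop where
  a : M (r - 1) = s.a
  b : M (r - 2) = s.b
  c : M (r - 3) = s.c
  d : M (r - 4) = s.d

theorem halts_stepProgram {B : ℕ} {M : Memory} {X W H : ℤ} {s : Coords}
    (hX : 2 * X + 1 ≤ B) (hW0 : 0 ≤ W) (hH0 : 0 ≤ H) (hWX : W ≤ X) (hHX : H ≤ X)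
    (hs : s.Nonneg) (hb : s.Bounded X X) (hone : M (-2) = 1) (hW : M (-28) = W)
    (hH : M (-29) = H) (hM : Stores M (-30) s) :
    Halts B stepProgram M fun t M' => t ≤ 12 ∧ Stores M' (-30) (s.step W H) ∧
      ∀ z, -30 ≤ z → M' z = M z := by
  obtain ⟨ha, hb', hc, hd⟩ := hM
  obtain ⟨sa, sb, sc, sd⟩ := hs
  obtain ⟨ba, bb, bc, bd⟩ := hb
  norm_num at ha hb' hc hd
  have fr : ∀ z : ℤ, -30 ≤ z → z ≠ -31 ∧ z ≠ -32 ∧ z ≠ -33 ∧ z ≠ -34 ∧ z ≠ -35 ∧ z ≠ -36 := by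
    intro z hz; omega
  unfold stepProgram Coords.step
  refine halts_seq (halts_op (s.a + s.c) (by simp [Op.eval, ha, hc]) (by rw [abs_le]; omega) ?_)
  refine halts_seq (halts_op (W - (s.a + s.c)) (by simp [Op.eval, hW])
    (by rw [abs_le]; omega) ?_)
  refine halts_seq (halts_op (W - (s.a + s.c) + 1) (by simp [Op.eval, hone])
    (by rw [abs_le]; omega) ?_)
  refine halts_ifPos (W - (s.a + s.c) + 1) (by simp) (fun h1 => ?_) (fun h1 => ?_)
  · rw [if_pos (by omega)]
    refine halts_seq (halts_op (s.b - s.d) (by simp [Op.eval, hb', hd])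
      (by rw [abs_le]; omega) ?_)
    refine halts_ifPos (s.b - s.d) (by simp) (fun h2 => ?_) (fun h2 => ?_)
    · rw [if_pos (by omega)]
      refine halts_seq (halts_op (s.b - H) (by simp [Op.eval, hb', hH])
        (by rw [abs_le]; omega) ?_)
      refine halts_ifPos (s.b - H) (by simp) (fun h3 => ?_) (fun h3 => ?_)
      · rw [if_pos (by omega)]
        refine halts_seq (halts_op (s.a + s.c) (by simp [Op.eval, ha, hc])
          (by rw [abs_le]; omega) ?_)
        refine halts_op (s.b - s.d) (by simp [Op.eval, hb', hd]) (by rw [abs_le]; omega) ?_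
        refine ⟨by norm_num, ⟨?_, ?_, ?_, ?_⟩, ?_⟩
        all_goals simp +contextual [hc, hd, fr]
      · rw [if_neg (by omega)]
        refine halts_skip ⟨by norm_num, ⟨?_, ?_, ?_, ?_⟩, ?_⟩
        all_goals simp +contextual [ha, hb', hc, hd, fr]
    · rw [if_neg (by omega)]
      refine halts_seq (halts_op (s.d - H) (by simp [Op.eval, hd, hH])
        (by rw [abs_le]; omega) ?_)
      refine halts_ifPos (s.d - H) (by simp) (fun h3 => ?_) (fun h3 => ?_)
      · rw [if_pos (by omega)]
        refine halts_seq (halts_op (s.c + s.a) (by simp [Op.eval, ha, hc])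
          (by rw [abs_le]; omega) ?_)
        refine halts_op (s.d - s.b) (by simp [Op.eval, hb', hd]) (by rw [abs_le]; omega) ?_
        refine ⟨by norm_num, ⟨?_, ?_, ?_, ?_⟩, ?_⟩
        all_goals simp +contextual [ha, hb', fr]
      · rw [if_neg (by omega)]
        refine halts_skip ⟨by norm_num, ⟨?_, ?_, ?_, ?_⟩, ?_⟩
        all_goals simp +contextual [ha, hb', hc, hd, fr]
  · rw [if_neg (by omega)]
    refine halts_skip ⟨by norm_num, ⟨?_, ?_, ?_, ?_⟩, ?_⟩
    all_goals simp +contextual [ha, hb', hc, hd, fr]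

/-- The walk; the cell `-30` holds the number of steps. -/
def walkProgram : Program :=
  .whilePos (-30) (.seq stepProgram (.op .sub (-30) (-30) (-2)))

theorem halts_walkProgram {B : ℕ} {M : Memory} {X W H : ℤ} {s : Coords}
    (hX : 2 * X + 1 ≤ B) (hW0 : 0 ≤ W) (hH0 : 0 ≤ H) (hWX : W ≤ X) (hHX : H ≤ X)
    (hs : s.Nonneg) (hb : s.Bounded X X) (hone : M (-2) = 1) (hW : M (-28) = W)
    (hH : M (-29) = H) (hM : Stores M (-30) s) (m : ℕ) (hm : M (-30) = m) (hmB : m ≤ B) :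
    Halts B walkProgram M fun t M' => t ≤ m * 14 + 1 ∧ Stores M' (-30) ((Coords.step W H)^[m] s) ∧
      ∀ z, -29 ≤ z → M' z = M z := by
  refine (halts_loop (T := 13) (fun j M' => M' (-30) = j ∧ (∀ z, -29 ≤ z → M' z = M z) ∧
    ∃ r, r + j = m ∧ Stores M' (-30) ((Coords.step W H)^[r] s)) (fun _ _ h => h.1) ?_ m M
    ⟨hm, fun _ _ => rfl, 0, by simp, hM⟩).mono ?_
  · rintro j M₁ ⟨hj, hfr, r, hr, hst⟩
    refine halts_seq ((halts_stepProgram hX hW0 hH0 hWX hHX (hs.iterate W H r)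
      (hb.iterate hWX hs r) (by rw [hfr _ (by norm_num), hone]) (by rw [hfr _ (by norm_num), hW])
      (by rw [hfr _ (by norm_num), hH]) hst).mono ?_)
    rintro t M₂ ⟨ht, hst₂, hfr₂⟩
    refine halts_op j ?_ (by rw [abs_le]; omega) ⟨by omega, by simp, ?_, r + 1, by omega, ?_⟩
    · rw [Op.eval, hfr₂ (-30) (by norm_num), hfr₂ (-2) (by norm_num), hfr (-2) (by norm_num), hone,
        hj]
      simp
    · intro z hz
      rw [Function.update_of_ne (by omega), hfr₂ z (by omega), hfr z hz]
    · rw [Function.iterate_succ_apply']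
      obtain ⟨h1, h2, h3, h4⟩ := hst₂
      exact ⟨by simpa using h1, by simpa using h2, by simpa using h3, by simpa using h4⟩
  · rintro t M' ⟨ht, -, hfr, r, hr, hst⟩
    obtain rfl : r = m := by omega
    exact ⟨ht, hst, hfr⟩

/-- Clear the flag `-26` unless the coordinates certify that the rectangle is pierced. -/
def testProgram : Program :=
  .seq (.op .add (-35) (-31) (-33)) <|
  .seq (.op .sub (-35) (-28) (-35)) <|
  .seq (.op .add (-35) (-35) (-2)) <|
  .ifPos (-35)
    (.seq (.op .sub (-35) (-29) (-32)) <|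
      .seq (.op .add (-35) (-35) (-2)) <|
      .ifPos (-35)
        (.seq (.op .sub (-35) (-29) (-34)) <|
          .seq (.op .add (-35) (-35) (-2)) <|
          .ifPos (-35) .skip (.const (-26) 0))
        (.const (-26) 0))
    (.const (-26) 0)

open Classical in
theorem halts_testProgram {B : ℕ} {M : Memory} {X W H : ℤ} {s : Coords}
    (hX : 2 * X + 1 ≤ B) (hW0 : 0 ≤ W) (hH0 : 0 ≤ H) (hWX : W ≤ X) (hHX : H ≤ X)
    (hs : s.Nonneg) (hb : s.Bounded X X) (hone : M (-2) = 1) (hW : M (-28) = W)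
    (hH : M (-29) = H) (hM : Stores M (-30) s) :
    Halts B testProgram M fun t M' => t ≤ 12 ∧
      M' (-26) = (if s.Short W H then M (-26) else 0) ∧
      ∀ z, -34 ≤ z → z ≠ -26 → M' z = M z := by
  obtain ⟨ha, hb', hc, hd⟩ := hM
  obtain ⟨sa, sb, sc, sd⟩ := hs
  obtain ⟨ba, bb, bc, bd⟩ := hb
  norm_num at ha hb' hc hd
  have fr : ∀ z : ℤ, -34 ≤ z → z ≠ -35 := by intro z hz; omega
  unfold testProgram
  refine halts_seq (halts_op (s.a + s.c) (by simp [Op.eval, ha, hc]) (by rw [abs_le]; omega) ?_)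
  refine halts_seq (halts_op (W - (s.a + s.c)) (by simp [Op.eval, hW])
    (by rw [abs_le]; omega) ?_)
  refine halts_seq (halts_op (W - (s.a + s.c) + 1) (by simp [Op.eval, hone])
    (by rw [abs_le]; omega) ?_)
  refine halts_ifPos (W - (s.a + s.c) + 1) (by simp) (fun h1 => ?_) (fun h1 => ?_)
  · refine halts_seq (halts_op (H - s.b) (by simp [Op.eval, hb', hH])
      (by rw [abs_le]; omega) ?_)
    refine halts_seq (halts_op (H - s.b + 1) (by simp [Op.eval, hone])
      (by rw [abs_le]; omega) ?_)
    refine halts_ifPos (H - s.b + 1) (by simp) (fun h2 => ?_) (fun h2 => ?_)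
    · refine halts_seq (halts_op (H - s.d) (by simp [Op.eval, hd, hH])
        (by rw [abs_le]; omega) ?_)
      refine halts_seq (halts_op (H - s.d + 1) (by simp [Op.eval, hone])
        (by rw [abs_le]; omega) ?_)
      refine halts_ifPos (H - s.d + 1) (by simp) (fun h3 => ?_) (fun h3 => ?_)
      · refine halts_skip ⟨by norm_num, ?_, ?_⟩
        · rw [if_pos ⟨by omega, by omega, by omega⟩]
          simp
        · simp +contextual [fr]
      · refine halts_const (by simp) ⟨by norm_num, ?_, ?_⟩
        · rw [if_neg (fun h => by have := h.2.2; omega)]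
          simp
        · simp +contextual [fr]
    · refine halts_const (by simp) ⟨by norm_num, ?_, ?_⟩
      · rw [if_neg (fun h => by have := h.2.1; omega)]
        simp
      · simp +contextual [fr]
  · refine halts_const (by simp) ⟨by norm_num, ?_, ?_⟩
    · rw [if_neg (fun h => by have := h.1; omega)]
      simp
    · simp +contextual [fr]

/-! ### Testing a candidate against all rectangles -/

theorem inputMemory_zero {n : ℕ} (w h : Fin n → ℕ) : inputMemory w h 0 = n := by
  simp [inputMemory]

theorem inputMemory_neg {n : ℕ} (w h : Fin n → ℕ) {z : ℤ} (hz : z < 0) :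
    inputMemory w h z = 0 := by
  rw [inputMemory, if_neg (by omega)]
  refine Finset.sum_eq_zero fun i _ => ?_
  rw [if_neg (by omega), if_neg (by omega), add_zero]

theorem inputMemory_width {n : ℕ} (w h : Fin n → ℕ) (i : Fin n) :
    inputMemory w h (2 * (i : ℤ) + 1) = w i := by
  rw [inputMemory, if_neg (by omega), Finset.sum_eq_single i]
  · rw [if_pos rfl, if_neg (by omega), add_zero]
  · intro j _ hj
    have : (j : ℕ) ≠ i := fun h => hj (Fin.ext h)
    rw [if_neg (by omega), if_neg (by omega), add_zero]
  · simp

theorem inputMemory_height {n : ℕ} (w h : Fin n → ℕ) (i : Fin n) :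
    inputMemory w h (2 * (i : ℤ) + 2) = h i := by
  rw [inputMemory, if_neg (by omega), Finset.sum_eq_single i]
  · rw [if_neg (by omega), if_pos rfl, zero_add]
  · intro j _ hj
    have : (j : ℕ) ≠ i := fun h => hj (Fin.ext h)
    rw [if_neg (by omega), if_neg (by omega), add_zero]
  · simp

/-- The constants are in place and the input is untouched. -/
structure Ready {n : ℕ} (w h : Fin n → ℕ) (k : ℕ) (M : Memory) : Prop where
  zero : M (-1) = 0
  one : M (-2) = 1
  denom : M (-4) = 2 * (k : ℤ) ^ 2
  numer : M (-5) = 2 * (k : ℤ) ^ 3 + 1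
  fuel : M (-6) = ((3 * k ^ 2 + 1 : ℕ) : ℤ)
  input : ∀ z, 0 ≤ z → M z = inputMemory w h z

theorem Ready.of_agree {n : ℕ} {w h : Fin n → ℕ} {k : ℕ} {M M' : Memory} (hM : Ready w h k M)
    (hM' : ∀ z, -6 ≤ z → M' z = M z) : Ready w h k M' where
  zero := by rw [hM' _ (by norm_num), hM.zero]
  one := by rw [hM' _ (by norm_num), hM.one]
  denom := by rw [hM' _ (by norm_num), hM.denom]
  numer := by rw [hM' _ (by norm_num), hM.numer]
  fuel := by rw [hM' _ (by norm_num), hM.fuel]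
  input z hz := by rw [hM' _ (by omega), hM.input z hz]

/-- Two denominators and the numerators of a pair of vectors. -/
structure Candidate : Type where
  D₁ : ℤ
  D₂ : ℤ
  s : Coords

/-- The ranges over which the search runs. -/
structure Candidate.InRange (k : ℕ) (c : Candidate) : Prop where
  one_le_D₁ : 1 ≤ c.D₁
  D₁_le : c.D₁ ≤ 2 * (k : ℤ) ^ 2
  one_le_D₂ : 1 ≤ c.D₂
  D₂_le : c.D₂ ≤ 2 * (k : ℤ) ^ 2
  nonneg : c.s.Nonneg
  -- Coordinates of at most k with denominators of at most 2k² have numerators of at most 2k³.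
  bounded : c.s.Bounded (2 * (k : ℤ) ^ 3) (2 * (k : ℤ) ^ 3)

/-- The walk from the candidate reaches a certificate for the `w × h` rectangle. -/
def Candidate.Passes (k : ℕ) (c : Candidate) (w h : ℕ) : Prop :=
  c.s.Accepts (3 * k ^ 2 + 1) (w * c.D₁) (h * c.D₂)

/-- The candidate is in the six cells below `r`, followed by its determinant and the product of
its denominators. -/
structure Holds (M : Memory) (r : ℤ) (γ : Candidate) : Prop where
  D₁ : M (r - 1) = γ.D₁
  D₂ : M (r - 2) = γ.D₂
  a : M (r - 3) = γ.s.a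
  b : M (r - 4) = γ.s.b
  c : M (r - 5) = γ.s.c
  d : M (r - 6) = γ.s.d
  num : M (r - 7) = γ.s.det
  den : M (r - 8) = γ.D₁ * γ.D₂

theorem Holds.of_agree {M M' : Memory} {r : ℤ} {c : Candidate} (hM : Holds M r c)
    (hM' : ∀ z, r - 8 ≤ z → z < r → M' z = M z) : Holds M' r c where
  D₁ := by rw [hM' _ (by omega) (by omega), hM.D₁]
  D₂ := by rw [hM' _ (by omega) (by omega), hM.D₂]
  a := by rw [hM' _ (by omega) (by omega), hM.a]
  b := by rw [hM' _ (by omega) (by omega), hM.b]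
  c := by rw [hM' _ (by omega) (by omega), hM.c]
  d := by rw [hM' _ (by omega) (by omega), hM.d]
  num := by rw [hM' _ (by omega) (by omega), hM.num]
  den := by rw [hM' _ (by omega) (by omega), hM.den]

/-- Set up the walk for the rectangle whose number, counted from one, is in the cell `-27`. -/
def prepareProgram : Program :=
  -- Twice the number of the rectangle is the address of its height; the width is one cell before.
  .seq (.op .add (-35) (-27) (-27)) <|
  .seq (.load (-29) (-35)) <|
  .seq (.op .sub (-35) (-35) (-2)) <|
  .seq (.load (-28) (-35)) <|
  .seq (.op .mul (-28) (-28) (-16)) <|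
  .seq (.op .mul (-29) (-29) (-17)) <|
  -- Adding the zero in the cell `-1` copies a cell. Every rectangle starts anew from the basis of
  -- the candidate.
  .seq (.op .add (-31) (-18) (-1)) <|
  .seq (.op .add (-32) (-19) (-1)) <|
  .seq (.op .add (-33) (-20) (-1)) <|
  .seq (.op .add (-34) (-21) (-1)) <|
  .seq (.op .add (-30) (-6) (-1)) (.op .sub (-27) (-27) (-2))

/-- What the words have to hold. -/
structure Fits (B n k : ℕ) : Prop where
  card : 2 * (n : ℤ) ≤ B
  walk : 2 * (2 * (k : ℤ) ^ 3) + 1 ≤ B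
  fuel : 3 * k ^ 2 + 1 ≤ B
  -- Areas are compared by cross-multiplying determinants with products of denominators.
  compare : 2 * (2 * (k : ℤ) ^ 3) ^ 2 * (2 * (k : ℤ) ^ 2) ^ 2 ≤ B
  count : (2 * (k : ℤ) ^ 2) ^ 2 * (2 * (k : ℤ) ^ 3 + 1) ^ 4 ≤ B

theorem Candidate.InRange.scaled {k : ℕ} {c : Candidate} (hc : c.InRange k) {x : ℕ}
    (hx : x ≤ k) : (0 ≤ x * c.D₁ ∧ x * c.D₁ ≤ 2 * (k : ℤ) ^ 3) ∧
      (0 ≤ x * c.D₂ ∧ x * c.D₂ ≤ 2 * (k : ℤ) ^ 3) := by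
  have hx' : (x : ℤ) ≤ k := by exact_mod_cast hx
  have hx0 : (0 : ℤ) ≤ x := Int.natCast_nonneg x
  obtain ⟨h1, h2, h3, h4, -, -⟩ := hc
  have e : 2 * (k : ℤ) ^ 3 = k * (2 * k ^ 2) := by ring
  rw [e]
  exact ⟨⟨by positivity, mul_le_mul hx' h2 (by omega) (by omega)⟩,
    ⟨by positivity, mul_le_mul hx' h4 (by omega) (by omega)⟩⟩

theorem halts_prepareProgram {B n k : ℕ} (hB : Fits B n k) {w h : Fin n → ℕ} {M : Memory}
    (hM : Ready w h k M) {c : Candidate} (hc : c.InRange k) (hMc : Holds M (-15) c) (i : Fin n)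
    (hw : w i ≤ k) (hh : h i ≤ k) (hi : M (-27) = (i : ℤ) + 1) :
    Halts B prepareProgram M fun t M' => t ≤ 12 ∧ M' (-27) = i ∧ M' (-28) = w i * c.D₁ ∧
      M' (-29) = h i * c.D₂ ∧ M' (-30) = ((3 * k ^ 2 + 1 : ℕ) : ℤ) ∧ Stores M' (-30) c.s ∧
      ∀ z, -26 ≤ z → M' z = M z := by
  obtain ⟨g1, g2, g3, g4, g5, g6, -, -⟩ := hMc
  norm_num at g1 g2 g3 g4 g5 g6
  obtain ⟨z0, z1, -, -, z4, z5⟩ := hM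
  have b1 := hB.card
  have b2 := hB.walk
  have b3 := hB.fuel
  obtain ⟨⟨k1, k2⟩, -⟩ := hc.scaled hw
  obtain ⟨-, ⟨k3, k4⟩⟩ := hc.scaled hh
  obtain ⟨sa, sb, sc, sd⟩ := hc.nonneg
  obtain ⟨ba, bb, bc, bd⟩ := hc.bounded
  have hin := i.2
  have l1 : (w i : ℤ) ≤ w i * c.D₁ := le_mul_of_one_le_right (by positivity) hc.one_le_D₁
  have l2 : (h i : ℤ) ≤ h i * c.D₂ := le_mul_of_one_le_right (by positivity) hc.one_le_D₂
  have fr : ∀ z : ℤ, -26 ≤ z → z ≠ -27 ∧ z ≠ -28 ∧ z ≠ -29 ∧ z ≠ -30 ∧ z ≠ -31 ∧ z ≠ -32 ∧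
      z ≠ -33 ∧ z ≠ -34 ∧ z ≠ -35 := by
    intro z hz; omega
  obtain ⟨A, hA⟩ : ∃ A : ℤ, A = 2 * (i : ℤ) + 2 := ⟨_, rfl⟩
  obtain ⟨A', hA'⟩ : ∃ A : ℤ, A = 2 * (i : ℤ) + 1 := ⟨_, rfl⟩
  have n1 := fr A (by omega)
  have n2 := fr A' (by omega)
  have hAh : M A = h i := by rw [z5 A (by omega), hA, inputMemory_height]
  have hAw : M A' = w i := by rw [z5 A' (by omega), hA', inputMemory_width]
  unfold prepareProgram
  refine halts_seq (halts_op A (by simp [Op.eval, hi, hA]; ring) (by rw [abs_le]; omega) ?_)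
  refine halts_seq (halts_load (h i) (by simp [n1, hAh]) (by rw [abs_le]; omega) ?_)
  refine halts_seq (halts_op A' (by simp [Op.eval, z1]; omega) (by rw [abs_le]; omega) ?_)
  refine halts_seq (halts_load (w i) (by simp [n2, hAw]) (by rw [abs_le]; omega) ?_)
  refine halts_seq (halts_op (w i * c.D₁) (by simp [Op.eval, g1]) (by rw [abs_le]; omega) ?_)
  refine halts_seq (halts_op (h i * c.D₂) (by simp [Op.eval, g2]) (by rw [abs_le]; omega) ?_)
  refine halts_seq (halts_op c.s.a (by simp [Op.eval, g3, z0]) (by rw [abs_le]; omega) ?_)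
  refine halts_seq (halts_op c.s.b (by simp [Op.eval, g4, z0]) (by rw [abs_le]; omega) ?_)
  refine halts_seq (halts_op c.s.c (by simp [Op.eval, g5, z0]) (by rw [abs_le]; omega) ?_)
  refine halts_seq (halts_op c.s.d (by simp [Op.eval, g6, z0]) (by rw [abs_le]; omega) ?_)
  refine halts_seq (halts_op ((3 * k ^ 2 + 1 : ℕ) : ℤ) (by simp [Op.eval, z4, z0])
    (by rw [abs_le]; omega) ?_)
  refine halts_op i (by simp [Op.eval, hi, z1]) (by rw [abs_le]; omega) ?_
  refine ⟨by norm_num, by simp, by simp, by simp, by simp, ⟨?_, ?_, ?_, ?_⟩, ?_⟩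
  all_goals simp +contextual [fr]

/-- Test all rectangles; the cell `-27` is the counter and `-26` the result. -/
def checkProgram : Program :=
  .whilePos (-27) (.seq prepareProgram (.seq walkProgram testProgram))

open Classical in
theorem halts_checkProgram {B n k : ℕ} (hB : Fits B n k) {w h : Fin n → ℕ} {M : Memory}
    (hw : ∀ i, w i ≤ k) (hh : ∀ i, h i ≤ k)
    (hM : Ready w h k M) {c : Candidate} (hc : c.InRange k) (hMc : Holds M (-15) c)
    (hn : M (-27) = n) (hok : M (-26) = 1) :
    Halts B checkProgram M fun t M' => t ≤ n * ((3 * k ^ 2 + 1) * 14 + 26) + 1 ∧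
      M' (-26) = (if ∀ i, c.Passes k (w i) (h i) then 1 else 0) ∧ ∀ z, -25 ≤ z → M' z = M z := by
  -- A round costs 12 steps of preparation, 14 for each step of the walk, one to leave the walk, and
  -- 12 for the test.
  refine (halts_loop (T := (3 * k ^ 2 + 1) * 14 + 25)
    (fun j M' => M' (-27) = j ∧ j ≤ n ∧ (∀ z, -25 ≤ z → M' z = M z) ∧
      M' (-26) = if ∀ i : Fin n, j ≤ i → c.Passes k (w i) (h i) then 1 else 0)
    (fun _ _ h => h.1) ?_ n M ⟨hn, le_rfl, fun _ _ => rfl, ?_⟩).mono ?_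
  · rintro j M₁ ⟨hj, hjn, hfr, hres⟩
    have hM₁ : Ready w h k M₁ := hM.of_agree fun z hz => hfr z (by omega)
    have hMc₁ : Holds M₁ (-15) c := hMc.of_agree fun z hz _ => hfr z (by omega)
    have b2 := hB.walk
    let i : Fin n := ⟨j, hjn⟩
    obtain ⟨⟨k1, k2⟩, -⟩ := hc.scaled (hw i)
    obtain ⟨-, ⟨k3, k4⟩⟩ := hc.scaled (hh i)
    refine halts_seq ((halts_prepareProgram hB hM₁ hc hMc₁ i (hw i) (hh i)
      (by rw [hj]; simp [i])).mono ?_)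
    rintro t₂ M₂ ⟨ht₂, hi₂, hW₂, hH₂, hf₂, hs₂, hfr₂⟩
    refine halts_seq ((halts_walkProgram hB.walk k1 k3 k2 k4 hc.nonneg hc.bounded
      (by rw [hfr₂ _ (by norm_num), hM₁.one]) hW₂ hH₂ hs₂ _ hf₂ hB.fuel).mono ?_)
    rintro t₃ M₃ ⟨ht₃, hs₃, hfr₃⟩
    refine (halts_testProgram hB.walk k1 k3 k2 k4 (hc.nonneg.iterate _ _ _)
      (hc.bounded.iterate k2 hc.nonneg _)
      (by rw [hfr₃ _ (by norm_num), hfr₂ _ (by norm_num), hM₁.one])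
      (by rw [hfr₃ _ (by norm_num), hW₂]) (by rw [hfr₃ _ (by norm_num), hH₂]) hs₃).mono ?_
    rintro t₄ M₄ ⟨ht₄, hres₄, hfr₄⟩
    refine ⟨by omega, ?_, by omega, ?_, ?_⟩
    · rw [hfr₄ _ (by norm_num) (by norm_num), hfr₃ _ (by norm_num), hi₂]
    · intro z hz
      rw [hfr₄ _ (by omega) (by omega), hfr₃ _ (by omega), hfr₂ _ (by omega), hfr z hz]
    · replace hres₄ : M₄ (-26) = if c.Passes k (w i) (h i) then M₃ (-26) else 0 := hres₄
      rw [hres₄, hfr₃ _ (by norm_num), hfr₂ _ (by norm_num), hres]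
      by_cases hp : c.Passes k (w i) (h i)
      · rw [if_pos hp]
        refine if_congr ⟨fun H i' hi' => ?_, fun H i' hi' => H i' (by omega)⟩ rfl rfl
        rcases hi'.lt_or_eq with h1 | h1
        · exact H i' h1
        · obtain rfl : i = i' := Fin.ext h1
          exact hp
      · rw [if_neg hp, if_neg fun H => hp (H i le_rfl)]
  · rw [hok, if_pos]
    intro i hi
    exact absurd i.2 (not_lt.2 hi)
  · rintro t M' ⟨ht, -, -, hfr, hres⟩
    refine ⟨ht, ?_, hfr⟩
    rw [hres]
    exact if_congr (by simp) rfl rfl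

/-! ### Enumeration of the candidates by a mixed radix counter -/

/-- `M[d] := x mod b` and `x := x / b`, where `x = M[-24]` and `b` is in the cell `y`. -/
def digitProgram (d y : ℤ) : Program :=
  .seq (.op .div (-25) (-24) y) <|
  .seq (.op .mul (-35) (-25) y) <|
  .seq (.op .sub d (-24) (-35)) (.op .add (-24) (-25) (-1))

theorem halts_digitProgram {B : ℕ} {M : Memory} {d y x b : ℤ} (hd : d < -7) (hd' : -22 < d)
    (hy : -7 < y) (hzero : M (-1) = 0) (hx : M (-24) = x) (hb : M y = b) (hx0 : 0 ≤ x)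
    (hxB : x ≤ B) (hb0 : 0 < b) :
    Halts B (digitProgram d y) M fun t M' => t ≤ 4 ∧ M' (-24) = x / b ∧ M' d = x % b ∧
      ∀ z, -24 < z → z ≠ d → M' z = M z := by
  have h1 : 0 ≤ x / b := Int.ediv_nonneg hx0 hb0.le
  have h2 : x / b ≤ x := Int.ediv_le_self b hx0
  have h3 : 0 ≤ x % b := Int.emod_nonneg x hb0.ne'
  have h4 : x / b * b + x % b = x := by rw [mul_comm]; exact Int.mul_ediv_add_emod x b
  have h5 : 0 ≤ x / b * b := mul_nonneg h1 hb0.le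
  unfold digitProgram
  have f1 : y ≠ -25 ∧ y ≠ -35 := by omega
  have f2 : (-1) ≠ d ∧ (-24) ≠ d ∧ (-25) ≠ d ∧ d ≠ -24 := by omega
  have fr : ∀ z : ℤ, -24 < z → z ≠ -24 ∧ z ≠ -25 ∧ z ≠ -35 := by intro z hz; omega
  refine halts_seq (halts_op (x / b) (by simp [Op.eval, hx, hb]) (by rw [abs_le]; omega) ?_)
  refine halts_seq (halts_op (x / b * b) (by simp [Op.eval, hb, f1]) (by rw [abs_le]; omega) ?_)
  refine halts_seq (halts_op (x % b) (by simp [Op.eval, hx]; omega) (by rw [abs_le]; omega) ?_)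
  refine halts_op (x / b) (by simp [Op.eval, hzero, f2]) (by rw [abs_le]; omega) ?_
  refine ⟨by norm_num, by simp, by simp [f2], ?_⟩
  simp +contextual [fr]

/-- The candidate whose digits are those of `x` in the mixed radix system with the bases
`E, E, F, F, F, F`. -/
def decode (E F x : ℤ) : Candidate :=
  ⟨x % E + 1, x / E % E + 1,
    ⟨x / E / E % F, x / E / E / F % F, x / E / E / F / F % F, x / E / E / F / F / F % F⟩⟩

theorem decode_inRange {k : ℕ} (hk : 1 ≤ k) (x : ℤ) :
    (decode (2 * (k : ℤ) ^ 2) (2 * (k : ℤ) ^ 3 + 1) x).InRange k := by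
  have hE : 0 < 2 * (k : ℤ) ^ 2 := by positivity
  have hF : 0 < 2 * (k : ℤ) ^ 3 + 1 := by positivity
  have e1 := fun y => Int.emod_nonneg y hE.ne'
  have e2 := fun y => Int.emod_lt_of_pos y hE
  have e3 := fun y => Int.emod_nonneg y hF.ne'
  have e4 := fun y => Int.emod_lt_of_pos y hF
  exact ⟨by simpa [decode] using e1 _, e2 _, by simpa [decode] using e1 _, e2 _,
    ⟨e3 _, e3 _, e3 _, e3 _⟩,
    ⟨Int.lt_add_one_iff.1 (e4 _), Int.lt_add_one_iff.1 (e4 _), Int.lt_add_one_iff.1 (e4 _),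
      Int.lt_add_one_iff.1 (e4 _)⟩⟩

/-- The counter is the Horner value of the digits, the denominators being shifted by one to start at
0. So a single loop reaches all candidates. -/
theorem exists_decode_eq {k : ℕ} {c : Candidate} (hc : c.InRange k) :
    ∃ x : ℕ, (x : ℤ) < (2 * (k : ℤ) ^ 2) ^ 2 * (2 * (k : ℤ) ^ 3 + 1) ^ 4 ∧
      decode (2 * (k : ℤ) ^ 2) (2 * (k : ℤ) ^ 3 + 1) x = c := by
  obtain ⟨⟨D₁, D₂, ⟨a, b, c, d⟩⟩, rfl⟩ : ∃ c', c' = c := ⟨c, rfl⟩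
  obtain ⟨h1, h2, h3, h4, ⟨ha, hb, hc, hd⟩, ⟨ha', hb', hc', hd'⟩⟩ := hc
  simp only at h1 h2 h3 h4 ha hb hc hd ha' hb' hc' hd'
  set E : ℤ := 2 * (k : ℤ) ^ 2
  set F : ℤ := 2 * (k : ℤ) ^ 3 + 1 with hF
  have horner : ∀ {b r q n : ℤ}, 0 ≤ r → r < b → 0 ≤ q → q < n → 0 ≤ r + b * q ∧
      r + b * q < b * n ∧ (r + b * q) % b = r ∧ (r + b * q) / b = q := by
    intro b r q n hr hrb hq hqn
    refine ⟨add_nonneg hr (mul_nonneg (by omega) hq), ?_, ?_, ?_⟩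
    · nlinarith
    · rw [Int.add_mul_emod_self_left, Int.emod_eq_of_lt hr hrb]
    · rw [Int.add_mul_ediv_left _ _ (by omega), Int.ediv_eq_zero_of_lt hr hrb, zero_add]
  obtain ⟨p5, q5, r5, s5⟩ := horner (b := F) hc (by omega) hd (show d < F by omega)
  obtain ⟨p4, q4, r4, s4⟩ := horner (b := F) hb (by omega) p5 q5
  obtain ⟨p3, q3, r3, s3⟩ := horner (b := F) ha (by omega) p4 q4
  obtain ⟨p2, q2, r2, s2⟩ := horner (b := E) (r := D₂ - 1) (by omega) (by omega) p3 q3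
  obtain ⟨p1, q1, r1, s1⟩ := horner (b := E) (r := D₁ - 1) (by omega) (by omega) p2 q2
  obtain ⟨x, hx⟩ := Int.eq_ofNat_of_zero_le p1
  refine ⟨x, ?_, ?_⟩
  · rw [← hx]
    calc _ < _ := q1
      _ = _ := by ring
  · rw [← hx]
    simp only [decode, r1, s1, r2, s2, r3, s3, r4, s4, r5, s5, sub_add_cancel]
    rw [Int.emod_eq_of_lt hd (by omega)]

/-- Decode the counter in the cell `-7` to the cells `-16, …, -23`. -/
def decodeProgram : Program :=
  -- The loop counter runs down to 1, whereas the codes start at 0.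
  .seq (.op .sub (-24) (-7) (-2)) <|
  .seq (digitProgram (-16) (-4)) <|
  .seq (digitProgram (-17) (-4)) <|
  .seq (digitProgram (-18) (-5)) <|
  .seq (digitProgram (-19) (-5)) <|
  .seq (digitProgram (-20) (-5)) <|
  .seq (digitProgram (-21) (-5)) <|
  .seq (.op .add (-16) (-16) (-2)) <|
  .seq (.op .add (-17) (-17) (-2)) <|
  .seq (.op .mul (-22) (-18) (-21)) <|
  .seq (.op .mul (-35) (-19) (-20)) <|
  .seq (.op .add (-22) (-22) (-35)) (.op .mul (-23) (-16) (-17))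

theorem Candidate.InRange.det_nonneg {k : ℕ} {c : Candidate} (hc : c.InRange k) : 0 ≤ c.s.det := by
  obtain ⟨sa, sb, sc, sd⟩ := hc.nonneg
  rw [Coords.det]
  positivity

theorem Candidate.InRange.det_le {k : ℕ} {c : Candidate} (hc : c.InRange k) :
    c.s.det ≤ 2 * (2 * (k : ℤ) ^ 3) ^ 2 := by
  obtain ⟨sa, sb, sc, sd⟩ := hc.nonneg
  obtain ⟨ba, bb, bc, bd⟩ := hc.bounded
  have h0 : (0 : ℤ) ≤ 2 * (k : ℤ) ^ 3 := by positivity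
  have h1 := mul_le_mul ba bd sd h0
  have h2 := mul_le_mul bb bc sc h0
  rw [Coords.det]
  linarith

theorem Candidate.InRange.den_pos {k : ℕ} {c : Candidate} (hc : c.InRange k) :
    0 < c.D₁ * c.D₂ :=
  mul_pos (by linarith [hc.one_le_D₁]) (by linarith [hc.one_le_D₂])

theorem Candidate.InRange.den_le {k : ℕ} {c : Candidate} (hc : c.InRange k) :
    c.D₁ * c.D₂ ≤ (2 * (k : ℤ) ^ 2) ^ 2 := by
  rw [sq (2 * (k : ℤ) ^ 2)]
  exact mul_le_mul hc.D₁_le hc.D₂_le (by linarith [hc.one_le_D₂]) (by positivity)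

theorem Fits.le_of_det_den {B n k : ℕ} (hB : Fits B n k) (hk : 1 ≤ k) {x y : ℤ} (hx : 0 ≤ x)
    (hx' : x ≤ 2 * (2 * (k : ℤ) ^ 3) ^ 2) (hy : 0 < y) (hy' : y ≤ (2 * (k : ℤ) ^ 2) ^ 2) :
    x * y ≤ B ∧ x ≤ B ∧ y ≤ B := by
  have h1 : (1 : ℤ) ≤ k := by exact_mod_cast hk
  have h2 : (1 : ℤ) ≤ 2 * (2 * (k : ℤ) ^ 3) ^ 2 := by
    have : (0 : ℤ) < 2 * (2 * (k : ℤ) ^ 3) ^ 2 := by positivity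
    omega
  have h3 := mul_le_mul hx' hy' hy.le (by positivity)
  have h4 := mul_le_mul h2 hy' hy.le (by positivity)
  have h5 := hB.compare
  have h6 : x ≤ x * y := le_mul_of_one_le_right hx hy
  exact ⟨h3.trans h5, by linarith, by linarith⟩

theorem halts_decodeProgram {B n k : ℕ} (hB : Fits B n k) (hk : 1 ≤ k) {w h : Fin n → ℕ}
    {M : Memory} (hM : Ready w h k M) {x : ℕ} (hx : M (-7) = (x : ℤ) + 1)
    (hxc : (x : ℤ) < (2 * (k : ℤ) ^ 2) ^ 2 * (2 * (k : ℤ) ^ 3 + 1) ^ 4) :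
    Halts B decodeProgram M fun t M' => t ≤ 31 ∧
      Holds M' (-15) (decode (2 * (k : ℤ) ^ 2) (2 * (k : ℤ) ^ 3 + 1) x) ∧
      ∀ z, -15 ≤ z → M' z = M z := by
  have hc := decode_inRange hk x
  have e1 := hc.one_le_D₁
  have e2 := hc.D₁_le
  have e3 := hc.one_le_D₂
  have e4 := hc.D₂_le
  have e5 := hc.det_nonneg
  have e6 := hc.det_le
  obtain ⟨sa, sb, sc, sd⟩ := hc.nonneg
  obtain ⟨m1, m2, m3⟩ := hB.le_of_det_den hk e5 e6 hc.den_pos hc.den_le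
  have n1 := hc.den_pos
  have b1 := hB.count
  have b2 := hB.fuel
  have b3 : (2 : ℤ) * k ^ 2 ≤ B := by
    zify at b2
    nlinarith
  have hE : 0 < 2 * (k : ℤ) ^ 2 := by positivity
  have hF : 0 < 2 * (k : ℤ) ^ 3 + 1 := by positivity
  have z0 := hM.zero
  have z1 := hM.one
  have z4 := hM.denom
  have z5 := hM.numer
  set c := decode (2 * (k : ℤ) ^ 2) (2 * (k : ℤ) ^ 3 + 1) x with hcdef
  rw [Coords.det] at e5 m2
  have m4 : 0 ≤ c.s.a * c.s.d := mul_nonneg sa sd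
  have m5 : 0 ≤ c.s.b * c.s.c := mul_nonneg sb sc
  set E : ℤ := 2 * (k : ℤ) ^ 2
  set F : ℤ := 2 * (k : ℤ) ^ 3 + 1
  have x0 : (0 : ℤ) ≤ x := by positivity
  have x1 : 0 ≤ (x : ℤ) / E ∧ (x : ℤ) / E ≤ x :=
    ⟨Int.ediv_nonneg x0 hE.le, Int.ediv_le_self _ x0⟩
  have x2 : 0 ≤ (x : ℤ) / E / E ∧ (x : ℤ) / E / E ≤ x :=
    ⟨Int.ediv_nonneg x1.1 hE.le, (Int.ediv_le_self _ x1.1).trans x1.2⟩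
  have x3 : 0 ≤ (x : ℤ) / E / E / F ∧ (x : ℤ) / E / E / F ≤ x :=
    ⟨Int.ediv_nonneg x2.1 hF.le, (Int.ediv_le_self _ x2.1).trans x2.2⟩
  have x4 : 0 ≤ (x : ℤ) / E / E / F / F ∧ (x : ℤ) / E / E / F / F ≤ x :=
    ⟨Int.ediv_nonneg x3.1 hF.le, (Int.ediv_le_self _ x3.1).trans x3.2⟩
  have x5 : 0 ≤ (x : ℤ) / E / E / F / F / F ∧ (x : ℤ) / E / E / F / F / F ≤ x :=
    ⟨Int.ediv_nonneg x4.1 hF.le, (Int.ediv_le_self _ x4.1).trans x4.2⟩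
  unfold decodeProgram
  refine halts_seq (halts_op (x : ℤ) (by simp [Op.eval, hx, z1]) (by rw [abs_le]; omega) ?_)
  have fr₀ : ∀ z, -24 < z → Function.update M (-24) (x : ℤ) z = M z := fun z hz =>
    Function.update_of_ne (by omega) _ _
  have g₀ : Function.update M (-24) (x : ℤ) (-24) = x := Function.update_self _ _ _
  generalize Function.update M (-24) (x : ℤ) = M₀ at fr₀ g₀
  refine halts_seq ((halts_digitProgram (by norm_num) (by norm_num) (by norm_num)
    (by rw [fr₀ _ (by norm_num), z0]) g₀ (by rw [fr₀ _ (by norm_num), z4]) x0 (by omega)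
    hE).mono ?_)
  rintro t₁ M₁ ⟨ht₁, g₁, d₁, fr₁⟩
  have fr₁' : ∀ z, -16 < z → M₁ z = M z := fun z hz => by
    rw [fr₁ z (by omega) (by omega), fr₀ z (by omega)]
  refine halts_seq ((halts_digitProgram (by norm_num) (by norm_num) (by norm_num)
    (by rw [fr₁' _ (by norm_num), z0]) g₁ (by rw [fr₁' _ (by norm_num), z4]) x1.1 (by omega)
    hE).mono ?_)
  rintro t₂ M₂ ⟨ht₂, g₂, d₂, fr₂⟩
  have fr₂' : ∀ z, -16 < z → M₂ z = M z := fun z hz => by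
    rw [fr₂ z (by omega) (by omega), fr₁' z (by omega)]
  refine halts_seq ((halts_digitProgram (by norm_num) (by norm_num) (by norm_num)
    (by rw [fr₂' _ (by norm_num), z0]) g₂ (by rw [fr₂' _ (by norm_num), z5]) x2.1 (by omega)
    hF).mono ?_)
  rintro t₃ M₃ ⟨ht₃, g₃, d₃, fr₃⟩
  have fr₃' : ∀ z, -16 < z → M₃ z = M z := fun z hz => by
    rw [fr₃ z (by omega) (by omega), fr₂' z (by omega)]
  refine halts_seq ((halts_digitProgram (by norm_num) (by norm_num) (by norm_num)
    (by rw [fr₃' _ (by norm_num), z0]) g₃ (by rw [fr₃' _ (by norm_num), z5]) x3.1 (by omega)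
    hF).mono ?_)
  rintro t₄ M₄ ⟨ht₄, g₄, d₄, fr₄⟩
  have fr₄' : ∀ z, -16 < z → M₄ z = M z := fun z hz => by
    rw [fr₄ z (by omega) (by omega), fr₃' z (by omega)]
  refine halts_seq ((halts_digitProgram (by norm_num) (by norm_num) (by norm_num)
    (by rw [fr₄' _ (by norm_num), z0]) g₄ (by rw [fr₄' _ (by norm_num), z5]) x4.1 (by omega)
    hF).mono ?_)
  rintro t₅ M₅ ⟨ht₅, g₅, d₅, fr₅⟩
  have fr₅' : ∀ z, -16 < z → M₅ z = M z := fun z hz => by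
    rw [fr₅ z (by omega) (by omega), fr₄' z (by omega)]
  refine halts_seq ((halts_digitProgram (by norm_num) (by norm_num) (by norm_num)
    (by rw [fr₅' _ (by norm_num), z0]) g₅ (by rw [fr₅' _ (by norm_num), z5]) x5.1 (by omega)
    hF).mono ?_)
  rintro t₆ M₆ ⟨ht₆, -, d₆, fr₆⟩
  have fr₆' : ∀ z, -16 < z → M₆ z = M z := fun z hz => by
    rw [fr₆ z (by omega) (by omega), fr₅' z (by omega)]
  have k1 : M₆ (-16) + 1 = c.D₁ := by
    rw [fr₆ _ (by norm_num) (by norm_num), fr₅ _ (by norm_num) (by norm_num),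
      fr₄ _ (by norm_num) (by norm_num), fr₃ _ (by norm_num) (by norm_num),
      fr₂ _ (by norm_num) (by norm_num), d₁]
    rfl
  have k2 : M₆ (-17) + 1 = c.D₂ := by
    rw [fr₆ _ (by norm_num) (by norm_num), fr₅ _ (by norm_num) (by norm_num),
      fr₄ _ (by norm_num) (by norm_num), fr₃ _ (by norm_num) (by norm_num), d₂]
    rfl
  have k3 : M₆ (-18) = c.s.a := by
    rw [fr₆ _ (by norm_num) (by norm_num), fr₅ _ (by norm_num) (by norm_num),
      fr₄ _ (by norm_num) (by norm_num), d₃]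
    rfl
  have k4 : M₆ (-19) = c.s.b := by
    rw [fr₆ _ (by norm_num) (by norm_num), fr₅ _ (by norm_num) (by norm_num), d₄]
    rfl
  have k5 : M₆ (-20) = c.s.c := by
    rw [fr₆ _ (by norm_num) (by norm_num), d₅]
    rfl
  have k6 : M₆ (-21) = c.s.d := d₆
  have k7 : M₆ (-2) = 1 := by rw [fr₆' _ (by norm_num), z1]
  clear_value c E F
  have fr : ∀ z : ℤ, -15 ≤ z → z ≠ -16 ∧ z ≠ -17 ∧ z ≠ -22 ∧ z ≠ -23 ∧ z ≠ -35 := by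
    intro z hz; omega
  refine halts_seq (halts_op c.D₁ (by simp [Op.eval, k1, k7]) (by rw [abs_le]; omega) ?_)
  refine halts_seq (halts_op c.D₂ (by simp [Op.eval, k2, k7]) (by rw [abs_le]; omega) ?_)
  refine halts_seq (halts_op (c.s.a * c.s.d) (by simp [Op.eval, k3, k6])
    (by rw [abs_le]; omega) ?_)
  refine halts_seq (halts_op (c.s.b * c.s.c) (by simp [Op.eval, k4, k5])
    (by rw [abs_le]; omega) ?_)
  refine halts_seq (halts_op (c.s.a * c.s.d + c.s.b * c.s.c) (by simp [Op.eval])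
    (by rw [abs_le]; omega) ?_)
  refine halts_op (c.D₁ * c.D₂) (by simp [Op.eval]) (by rw [abs_le]; omega) ?_
  refine ⟨by omega, ⟨?_, ?_, ?_, ?_, ?_, ?_, ?_, ?_⟩, fun z hz => ?_⟩
  all_goals norm_num
  · exact k3
  · exact k4
  · exact k5
  · exact k6
  · rfl
  · simp [fr z hz, fr₆' z (by omega)]

/-! ### The search for the best candidate -/

/-- Copy the decoded candidate to the cells `-8, …, -15` of the best one. -/
def copyProgram : Program :=
  .seq (.op .add (-8) (-16) (-1)) <|
  .seq (.op .add (-9) (-17) (-1)) <|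
  .seq (.op .add (-10) (-18) (-1)) <|
  .seq (.op .add (-11) (-19) (-1)) <|
  .seq (.op .add (-12) (-20) (-1)) <|
  .seq (.op .add (-13) (-21) (-1)) <|
  .seq (.op .add (-14) (-22) (-1)) (.op .add (-15) (-23) (-1))

theorem halts_copyProgram {B n k : ℕ} (hB : Fits B n k) (hk : 1 ≤ k) {w h : Fin n → ℕ}
    {M : Memory} (hM : Ready w h k M) {c : Candidate} (hc : c.InRange k)
    (hMc : Holds M (-15) c) :
    Halts B copyProgram M fun t M' => t ≤ 8 ∧ Holds M' (-7) c ∧ ∀ z, -7 ≤ z → M' z = M z := by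
  obtain ⟨g1, g2, g3, g4, g5, g6, g7, g8⟩ := hMc
  norm_num at g1 g2 g3 g4 g5 g6 g7 g8
  have z0 := hM.zero
  have b1 := hB.walk
  have b2 : (2 : ℤ) * k ^ 2 ≤ B := by
    have := hB.fuel
    zify at this
    nlinarith
  have b3 := hB.le_of_det_den hk hc.det_nonneg hc.det_le hc.den_pos hc.den_le
  have b4 := hc.det_nonneg
  have b5 := hc.den_pos
  obtain ⟨h1, h2, h3, h4, ⟨sa, sb, sc, sd⟩, ⟨ba, bb, bc, bd⟩⟩ := hc
  unfold copyProgram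
  refine halts_seq (halts_op c.D₁ (by simp [Op.eval, z0, g1]) (by rw [abs_le]; omega) ?_)
  refine halts_seq (halts_op c.D₂ (by simp [Op.eval, z0, g2]) (by rw [abs_le]; omega) ?_)
  refine halts_seq (halts_op c.s.a (by simp [Op.eval, z0, g3]) (by rw [abs_le]; omega) ?_)
  refine halts_seq (halts_op c.s.b (by simp [Op.eval, z0, g4]) (by rw [abs_le]; omega) ?_)
  refine halts_seq (halts_op c.s.c (by simp [Op.eval, z0, g5]) (by rw [abs_le]; omega) ?_)
  refine halts_seq (halts_op c.s.d (by simp [Op.eval, z0, g6]) (by rw [abs_le]; omega) ?_)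
  refine halts_seq (halts_op c.s.det (by simp [Op.eval, z0, g7]) (by rw [abs_le]; omega) ?_)
  refine halts_op (c.D₁ * c.D₂) (by simp [Op.eval, z0, g8]) (by rw [abs_le]; omega) ?_
  refine ⟨by norm_num, ⟨?_, ?_, ?_, ?_, ?_, ?_, ?_, ?_⟩, ?_⟩
  all_goals norm_num
  intro z hz
  have : z ≠ -8 ∧ z ≠ -9 ∧ z ≠ -10 ∧ z ≠ -11 ∧ z ≠ -12 ∧ z ≠ -13 ∧ z ≠ -14 ∧ z ≠ -15 := by omega
  simp [this]

/-- The area of a fundamental parallelogram. -/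
noncomputable def Candidate.value (c : Candidate) : ℝ :=
  ((c.s.det : ℤ) : ℝ) / ((c.D₁ * c.D₂ : ℤ) : ℝ)

/-- Least density means largest area, and the comparison of areas is cleared of denominators. -/
theorem Candidate.InRange.value_lt_iff {k : ℕ} {b c : Candidate} (hb : b.InRange k)
    (hc : c.InRange k) :
    b.value < c.value ↔ 0 < c.s.det * (b.D₁ * b.D₂) - b.s.det * (c.D₁ * c.D₂) := by
  have h1 : (0 : ℝ) < ((b.D₁ * b.D₂ : ℤ) : ℝ) := by exact_mod_cast hb.den_pos
  have h2 : (0 : ℝ) < ((c.D₁ * c.D₂ : ℤ) : ℝ) := by exact_mod_cast hc.den_pos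
  rw [Candidate.value, Candidate.value, div_lt_div_iff₀ h1 h2, sub_pos]
  exact_mod_cast Iff.rfl

/-- Replace the best candidate by the decoded one if that is better and passes all tests. -/
def improveProgram : Program :=
  .seq (.op .mul (-35) (-22) (-15)) <|
  .seq (.op .mul (-36) (-14) (-23)) <|
  .seq (.op .sub (-35) (-35) (-36)) <|
  .ifPos (-35)
    (.seq (.const (-26) 1) <|
      .seq (.op .add (-27) 0 (-1)) <|
      .seq checkProgram (.ifPos (-26) copyProgram .skip))
    .skip

open Classical in
theorem halts_improveProgram {B n k : ℕ} (hB : Fits B n k) (hk : 1 ≤ k) {w h : Fin n → ℕ}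
    (hw : ∀ i, w i ≤ k) (hh : ∀ i, h i ≤ k) {M : Memory} (hM : Ready w h k M) {b c : Candidate}
    (hb : b.InRange k) (hMb : Holds M (-7) b) (hc : c.InRange k) (hMc : Holds M (-15) c) :
    Halts B improveProgram M fun t M' => t ≤ n * ((3 * k ^ 2 + 1) * 14 + 26) + 16 ∧
      Holds M' (-7) (if b.value < c.value ∧ ∀ i, c.Passes k (w i) (h i) then c else b) ∧
      ∀ z, -7 ≤ z → M' z = M z := by
  have g1 := hMb.num
  have g2 := hMb.den
  have g3 := hMc.num
  have g4 := hMc.den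
  norm_num at g1 g2 g3 g4
  obtain ⟨p1, -, -⟩ := hB.le_of_det_den hk hc.det_nonneg hc.det_le hb.den_pos hb.den_le
  obtain ⟨p2, -, -⟩ := hB.le_of_det_den hk hb.det_nonneg hb.det_le hc.den_pos hc.den_le
  have p3 := mul_nonneg hc.det_nonneg hb.den_pos.le
  have p4 := mul_nonneg hb.det_nonneg hc.den_pos.le
  have b1 := hB.card
  have b2 := hB.walk
  have hk3 : (0 : ℤ) ≤ (k : ℤ) ^ 3 := by positivity
  have hin : M 0 = n := by rw [hM.input 0 le_rfl, inputMemory_zero]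
  have z0 := hM.zero
  unfold improveProgram
  refine halts_seq (halts_op (c.s.det * (b.D₁ * b.D₂)) (by simp [Op.eval, g2, g3])
    (by rw [abs_le]; omega) ?_)
  refine halts_seq (halts_op (b.s.det * (c.D₁ * c.D₂)) (by simp [Op.eval, g1, g4])
    (by rw [abs_le]; omega) ?_)
  refine halts_seq (halts_op (c.s.det * (b.D₁ * b.D₂) - b.s.det * (c.D₁ * c.D₂))
    (by simp [Op.eval]) (by rw [abs_le]; omega) ?_)
  refine halts_ifPos _ (Function.update_self _ _ _) (fun hlt => ?_) (fun hle => ?_)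
  · rw [← hb.value_lt_iff hc] at hlt
    refine halts_seq (halts_const (by rw [abs_le]; omega) ?_)
    refine halts_seq (halts_op (n : ℤ) (by simp [Op.eval, hin, z0]) (by rw [abs_le]; omega) ?_)
    generalize hM₁ : (Function.update _ (-27) (n : ℤ) : ℤ → ℤ) = M₁
    have fr₁ : ∀ z, -25 ≤ z → M₁ z = M z := by
      intro z hz
      have : z ≠ -26 ∧ z ≠ -27 ∧ z ≠ -35 ∧ z ≠ -36 := by omega
      simp [← hM₁, this]
    have hR₁ : Ready w h k M₁ := hM.of_agree fun z hz => fr₁ z (by omega)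
    have hc₁ : Holds M₁ (-15) c := hMc.of_agree fun z hz _ => fr₁ z (by omega)
    refine halts_seq ((halts_checkProgram hB hw hh hR₁ hc hc₁ (by simp [← hM₁])
      (by simp [← hM₁])).mono ?_)
    rintro t₂ M₂ ⟨ht₂, hres, fr₂⟩
    have fr₂' : ∀ z, -25 ≤ z → M₂ z = M z := fun z hz => by rw [fr₂ z hz, fr₁ z hz]
    refine halts_ifPos _ hres (fun hpos => ?_) (fun hneg => ?_)
    · have hall : ∀ i, c.Passes k (w i) (h i) := by
        by_contra hcon
        rw [if_neg hcon] at hpos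
        omega
      refine (halts_copyProgram hB hk (hM.of_agree fun z hz => fr₂' z (by omega)) hc
        (hMc.of_agree fun z hz _ => fr₂' z (by omega))).mono ?_
      rintro t₃ M₃ ⟨ht₃, hc₃, fr₃⟩
      refine ⟨by omega, ?_, fun z hz => by rw [fr₃ z hz, fr₂' z (by omega)]⟩
      rw [if_pos ⟨hlt, hall⟩]
      exact hc₃
    · have hall : ¬ ∀ i, c.Passes k (w i) (h i) := by
        intro hcon
        rw [if_pos hcon] at hneg
        omega
      refine halts_skip ⟨by omega, ?_, fun z hz => fr₂' z (by omega)⟩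
      rw [if_neg fun H => hall H.2]
      exact hMb.of_agree fun z hz _ => fr₂' z (by omega)
  · have hlt : ¬ b.value < c.value := by rw [hb.value_lt_iff hc]; omega
    have fr₁ : ∀ z : ℤ, -25 ≤ z → z ≠ -35 ∧ z ≠ -36 := by intro z hz; omega
    refine halts_skip ⟨by omega, ?_, fun z hz => ?_⟩
    · rw [if_neg fun H => hlt H.1]
      exact hMb.of_agree fun z hz _ => by simp [fr₁ z (by omega)]
    · simp [fr₁ z (by omega)]

/-- The search through all candidates; the counter is in the cell `-7`. -/
def searchProgram : Program :=
  .whilePos (-7) (.seq decodeProgram (.seq improveProgram (.op .sub (-7) (-7) (-2))))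

/-- The candidate stands for a piercing lattice. -/
structure Candidate.Sound {n : ℕ} (w h : Fin n → ℕ) (c : Candidate) : Prop where
  det_pos : 0 < c.s.det
  pierces : ∀ i, Pierces (w i) (h i) (c.s.lattice c.D₁ c.D₂)

/-- After the round for `j`, the best candidate is a piercing lattice and beats all passing
candidates with codes from `j` on. A round takes 31 steps to decode, the cost of `improveProgram`,
one to count and one for the loop test. -/
theorem halts_searchProgram {B n k : ℕ} (hB : Fits B n k) (hk : 1 ≤ k) {w h : Fin n → ℕ}
    (hw : ∀ i, w i ≤ k) (hh : ∀ i, h i ≤ k) {M : Memory} (hM : Ready w h k M) {b : Candidate}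
    (hb : b.InRange k) (hMb : Holds M (-7) b) (hbs : b.Sound w h) {N : ℕ}
    (hN : (N : ℤ) = (2 * (k : ℤ) ^ 2) ^ 2 * (2 * (k : ℤ) ^ 3 + 1) ^ 4) (hMN : M (-7) = N) :
    Halts B searchProgram M fun t M' =>
      t ≤ N * (n * ((3 * k ^ 2 + 1) * 14 + 26) + 49) + 1 ∧ Ready w h k M' ∧
      ∃ b' : Candidate, b'.InRange k ∧ b'.Sound w h ∧ Holds M' (-7) b' ∧
        ∀ c : Candidate, c.InRange k → (∀ i, c.Passes k (w i) (h i)) → c.value ≤ b'.value := by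
  refine (halts_loop (T := n * ((3 * k ^ 2 + 1) * 14 + 26) + 48)
    (fun j M' => M' (-7) = j ∧ j ≤ N ∧ Ready w h k M' ∧ ∃ b' : Candidate, b'.InRange k ∧
      b'.Sound w h ∧ Holds M' (-7) b' ∧ ∀ x : ℕ, j ≤ x → x < N →
        (∀ i, (decode (2 * (k : ℤ) ^ 2) (2 * (k : ℤ) ^ 3 + 1) x).Passes k (w i) (h i)) →
        (decode (2 * (k : ℤ) ^ 2) (2 * (k : ℤ) ^ 3 + 1) x).value ≤ b'.value)
    (fun _ _ h => h.1) ?_ N M ⟨hMN, le_rfl, hM, b, hb, hbs, hMb, by intros; omega⟩).mono ?_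
  · rintro j M₁ ⟨hj, hjN, hR, b', hb', hbs', hMb', hmax⟩
    have hjN' : (j : ℤ) < (2 * (k : ℤ) ^ 2) ^ 2 * (2 * (k : ℤ) ^ 3 + 1) ^ 4 := by
      rw [← hN]; exact_mod_cast hjN
    have hcount := hB.count
    refine halts_seq ((halts_decodeProgram hB hk hR (by rw [hj]; simp) hjN').mono ?_)
    rintro t₂ M₂ ⟨ht₂, hc₂, fr₂⟩
    have hc := decode_inRange hk j
    set c := decode (2 * (k : ℤ) ^ 2) (2 * (k : ℤ) ^ 3 + 1) j with hcdef
    refine halts_seq ((halts_improveProgram hB hk hw hh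
      (hR.of_agree fun z hz => fr₂ z (by omega)) hb'
      (hMb'.of_agree fun z hz _ => fr₂ z (by omega)) hc hc₂).mono ?_)
    rintro t₃ M₃ ⟨ht₃, hb₃, fr₃⟩
    have fr₃' : ∀ z, -7 ≤ z → M₃ z = M₁ z := fun z hz => by rw [fr₃ z hz, fr₂ z (by omega)]
    have fr₄ : ∀ z : ℤ, z ≠ -7 → Function.update M₃ (-7) (j : ℤ) z = M₃ z := fun z hz =>
      Function.update_of_ne hz _ _
    refine halts_op (j : ℤ) ?_ (by rw [abs_le]; omega) ⟨by omega, Function.update_self _ _ _,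
      by omega, ?_, ?_⟩
    · rw [Op.eval, fr₃' (-7) (by norm_num), fr₃' (-2) (by norm_num), hj, hR.one]
      push_cast
      ring
    · exact hR.of_agree fun z hz => by rw [fr₄ z (by omega), fr₃' z (by omega)]
    · have hMc := hb₃.of_agree (M' := Function.update M₃ (-7) (j : ℤ)) fun z _ hz =>
        fr₄ z (by omega)
      split_ifs at hMc with hif
      · refine ⟨c, hc, ⟨?_, ?_⟩, hMc, ?_⟩
        -- The enumeration contains degenerate pairs. Their area is 0, so they are never strictly
        -- better than the current best.
        · by_contra hcon
          have h0 : c.s.det = 0 := le_antisymm (not_lt.1 hcon) hc.det_nonneg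
          have h1 : c.value = 0 := by rw [Candidate.value, h0]; simp
          have h2 : 0 < b'.value := div_pos (by exact_mod_cast hbs'.det_pos)
            (by exact_mod_cast hb'.den_pos)
          linarith [hif.1]
        · intro i
          refine Coords.Accepts.pierces (by linarith [hc.one_le_D₁]) (by linarith [hc.one_le_D₂])
            hc.nonneg ?_ (hif.2 i)
          by_contra hcon
          have h0 : c.s.det = 0 := le_antisymm (not_lt.1 hcon) hc.det_nonneg
          have h1 : c.value = 0 := by rw [Candidate.value, h0]; simp
          have h2 : 0 < b'.value := div_pos (by exact_mod_cast hbs'.det_pos)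
            (by exact_mod_cast hb'.den_pos)
          linarith [hif.1]
        · intro x hx hxN hpass
          rcases hx.lt_or_eq with h1 | h1
          · exact (hmax x h1 hxN hpass).trans hif.1.le
          · rw [← h1]
      · refine ⟨b', hb', hbs', hMc, ?_⟩
        intro x hx hxN hpass
        rcases hx.lt_or_eq with h1 | h1
        · exact hmax x h1 hxN hpass
        · subst h1
          exact not_lt.1 fun hlt => hif ⟨hlt, hpass⟩
  · rintro t M' ⟨ht, -, -, hR, b', hb', hbs', hMb', hmax⟩
    refine ⟨ht, hR, b', hb', hbs', hMb', fun c hc hpass => ?_⟩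
    obtain ⟨x, hx, rfl⟩ := exists_decode_eq hc
    exact hmax x (Nat.zero_le x) (by rw [← hN] at hx; exact_mod_cast hx) hpass

/-! ### Initialisation -/

/-- Compute the largest extent in the cell `-3`. -/
def extentProgram : Program :=
  .seq (.const (-2) 1) <|
  -- Widths and heights fill the cells 1 to 2n, which are scanned alike. The cells `-1` and `-3` are
  -- 0 at the start; `-1` keeps this value as the constant zero.
  .seq (.op .add (-27) 0 0) <|
  .whilePos (-27) <|
    .seq (.load (-35) (-27)) <|
    .seq (.op .sub (-36) (-35) (-3)) <|
    .seq (.ifPos (-36) (.op .add (-3) (-35) (-1)) .skip) (.op .sub (-27) (-27) (-2))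

theorem width_le_maxExtent {n : ℕ} (w h : Fin n → ℕ) (i : Fin n) : w i ≤ maxExtent w h :=
  (le_max_left _ _).trans
    (Finset.le_sup (f := fun i => max (w i) (h i)) (Finset.mem_univ i))

theorem height_le_maxExtent {n : ℕ} (w h : Fin n → ℕ) (i : Fin n) : h i ≤ maxExtent w h :=
  (le_max_right _ _).trans
    (Finset.le_sup (f := fun i => max (w i) (h i)) (Finset.mem_univ i))

theorem inputMemory_mem {n : ℕ} (w h : Fin n → ℕ) {z : ℤ} (hz : 1 ≤ z) (hzn : z ≤ 2 * n) :
    0 ≤ inputMemory w h z ∧ inputMemory w h z ≤ maxExtent w h := by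
  rcases Int.even_or_odd' z with ⟨m, hm | hm⟩
  · obtain ⟨j, rfl⟩ : ∃ j : ℕ, m = (j : ℤ) + 1 := ⟨(m - 1).toNat, by omega⟩
    have := inputMemory_height w h ⟨j, by omega⟩
    rw [show z = 2 * (((⟨j, by omega⟩ : Fin n) : ℕ) : ℤ) + 2 by simp; omega, this]
    exact ⟨by positivity, by exact_mod_cast height_le_maxExtent w h _⟩
  · obtain ⟨j, rfl⟩ : ∃ j : ℕ, m = (j : ℤ) := ⟨m.toNat, by omega⟩
    have := inputMemory_width w h ⟨j, by omega⟩
    rw [show z = 2 * (((⟨j, by omega⟩ : Fin n) : ℕ) : ℤ) + 1 by simp; omega, this]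
    exact ⟨by positivity, by exact_mod_cast width_le_maxExtent w h _⟩

theorem halts_extentProgram {B n : ℕ} {w h : Fin n → ℕ} (hn : 1 ≤ n) (hnB : 2 * n ≤ B)
    (hkB : maxExtent w h ≤ B) :
    Halts B extentProgram (inputMemory w h) fun t M => t ≤ 2 * n * 6 + 3 ∧ M (-1) = 0 ∧
      M (-2) = 1 ∧ M (-3) = maxExtent w h ∧ ∀ z, 0 ≤ z → M z = inputMemory w h z := by
  unfold extentProgram
  have hM0 := inputMemory_zero w h
  refine halts_seq (halts_const (by rw [abs_le]; omega) ?_)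
  refine halts_seq (halts_op (2 * n : ℕ) (by simp [Op.eval, hM0]; ring) (by rw [abs_le]; omega) ?_)
  refine (halts_loop (T := 5) (fun j M => M (-27) = j ∧ j ≤ 2 * n ∧ M (-1) = 0 ∧ M (-2) = 1 ∧
    0 ≤ M (-3) ∧ M (-3) ≤ maxExtent w h ∧ (∀ z, 0 ≤ z → M z = inputMemory w h z) ∧
    ∀ z : ℤ, j < z → z ≤ 2 * n → inputMemory w h z ≤ M (-3)) (fun _ _ h => h.1) ?_ (2 * n) _
    ⟨by simp, le_rfl, ?_, ?_, ?_, ?_, ?_, ?_⟩).mono ?_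
  · rintro j M ⟨hj, hjn, h1, h2, h3, h4, h5, h6⟩
    have hA : M ((j + 1 : ℕ) : ℤ) = inputMemory w h ((j + 1 : ℕ) : ℤ) := h5 _ (by positivity)
    obtain ⟨i1, i2⟩ := inputMemory_mem w h (z := ((j + 1 : ℕ) : ℤ)) (by push_cast; omega) (by omega)
    have hlast : ∀ z : ℤ, (j : ℤ) < z → z = ((j + 1 : ℕ) : ℤ) ∨ ((j + 1 : ℕ) : ℤ) < z := by
      intro z hz; omega
    obtain ⟨v, hv⟩ : ∃ v, v = inputMemory w h ((j + 1 : ℕ) : ℤ) := ⟨_, rfl⟩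
    rw [← hv] at i1 i2 hA
    have fr : ∀ z : ℤ, 0 ≤ z → z ≠ -27 ∧ z ≠ -35 ∧ z ≠ -36 ∧ z ≠ -3 := by intro z hz; omega
    refine halts_seq (halts_load v (by rw [hj, hA]) (by rw [abs_le]; omega) ?_)
    refine halts_seq (halts_op (v - M (-3)) (by simp [Op.eval]) (by rw [abs_le]; omega) ?_)
    refine halts_seq (halts_ifPos _ (Function.update_self _ _ _) (fun hlt => ?_) (fun hle => ?_))
    · refine halts_op v (by simp [Op.eval, h1]) (by rw [abs_le]; omega) ?_
      refine halts_op (j : ℤ) (by simp [Op.eval, hj, h2]) (by rw [abs_le]; omega) ?_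
      refine ⟨by norm_num, by simp, by omega, by simpa using h1, by simpa using h2,
        by simpa using i1, by simpa using i2, fun z hz => by simp [fr z hz, h5 z hz], ?_⟩
      intro z hz hzn
      simp only [ne_eq, Int.reduceEq, not_false_eq_true, Function.update_of_ne,
        Function.update_self, Int.reduceNeg, Int.neg_inj]
      rcases hlast z hz with h | h
      · rw [h, ← hv]
      · have := h6 z h hzn
        omega
    · refine halts_skip ?_
      refine halts_op (j : ℤ) (by simp [Op.eval, hj, h2]) (by rw [abs_le]; omega) ?_
      refine ⟨by norm_num, by simp, by omega, by simpa using h1, by simpa using h2,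
        by simpa using h3, by simpa using h4, fun z hz => by simp [fr z hz, h5 z hz], ?_⟩
      intro z hz hzn
      simp only [ne_eq, Int.reduceEq, not_false_eq_true, Function.update_of_ne,
        Int.reduceNeg, Int.neg_inj]
      rcases hlast z hz with h | h
      · rw [h, ← hv]; omega
      · exact h6 z h hzn
  · simp [inputMemory_neg w h]
  · simp
  · simp [inputMemory_neg w h]
  · simp [inputMemory_neg w h]
  · intro z hz
    have : z ≠ -27 ∧ z ≠ -2 := by omega
    simp [this]
  · intro z h1 h2
    push_cast at h1
    omega
  · rintro t M ⟨ht, -, -, h1, h2, h3, h4, h5, h6⟩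
    refine ⟨by omega, h1, h2, le_antisymm h4 ?_, h5⟩
    obtain ⟨m, hm⟩ : ∃ m : ℕ, M (-3) = m := ⟨(M (-3)).toNat, by omega⟩
    rw [hm]
    have : maxExtent w h ≤ m := by
      refine Finset.sup_le fun i _ => max_le ?_ ?_
      · have := h6 (2 * (i : ℤ) + 1) (by push_cast; omega) (by have := i.2; omega)
        rw [inputMemory_width, hm] at this
        exact_mod_cast this
      · have := h6 (2 * (i : ℤ) + 2) (by push_cast; omega) (by have := i.2; omega)
        rw [inputMemory_height, hm] at this
        exact_mod_cast this
    exact_mod_cast this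

/-- Compute the constants of the search; the best candidate so far is the integer lattice. -/
def constantsProgram : Program :=
  .seq (.op .mul (-4) (-3) (-3)) <|
  .seq (.op .add (-6) (-4) (-4)) <|
  .seq (.op .add (-6) (-6) (-4)) <|
  .seq (.op .add (-6) (-6) (-2)) <|
  .seq (.op .mul (-5) (-4) (-3)) <|
  .seq (.op .add (-5) (-5) (-5)) <|
  .seq (.op .add (-5) (-5) (-2)) <|
  -- Until here the cell `-4` held k², from which 3k² + 1 and 2k³ + 1 were formed.
  .seq (.op .add (-4) (-4) (-4)) <|
  .seq (.op .mul (-24) (-4) (-4)) <|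
  .seq (.op .mul (-25) (-5) (-5)) <|
  .seq (.op .mul (-25) (-25) (-25)) <|
  .seq (.op .mul (-7) (-24) (-25)) <|
  .seq (.const (-8) 1) <|
  .seq (.const (-9) 1) <|
  .seq (.const (-10) 1) <|
  .seq (.const (-11) 0) <|
  .seq (.const (-12) 0) <|
  .seq (.const (-13) 1) <|
  .seq (.const (-14) 1) (.const (-15) 1)

theorem halts_constantsProgram {B n k : ℕ} (hB : Fits B n k) (hk : 1 ≤ k) {w h : Fin n → ℕ}
    {M : Memory} (h1 : M (-1) = 0) (h2 : M (-2) = 1) (h3 : M (-3) = k)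
    (hin : ∀ z, 0 ≤ z → M z = inputMemory w h z) :
    Halts B constantsProgram M fun t M' => t ≤ 20 ∧ Ready w h k M' ∧
      M' (-7) = (2 * (k : ℤ) ^ 2) ^ 2 * (2 * (k : ℤ) ^ 3 + 1) ^ 4 ∧
      Holds M' (-7) ⟨1, 1, ⟨1, 0, 0, 1⟩⟩ := by
  have b1 := hB.fuel
  zify at b1
  have b2 := hB.walk
  have b3 := hB.count
  have hk' : (1 : ℤ) ≤ k := by exact_mod_cast hk
  have p2 : 1 ≤ (k : ℤ) ^ 2 := one_le_pow₀ hk'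
  have p3 : 1 ≤ (k : ℤ) ^ 3 := one_le_pow₀ hk'
  have q1 : 1 ≤ (2 * (k : ℤ) ^ 2) ^ 2 := one_le_pow₀ (by omega)
  have q2 : 1 ≤ (2 * (k : ℤ) ^ 3 + 1) ^ 2 := one_le_pow₀ (by omega)
  have q3 : 1 ≤ (2 * (k : ℤ) ^ 3 + 1) ^ 4 := one_le_pow₀ (by omega)
  have q4 : (2 * (k : ℤ) ^ 3 + 1) ^ 2 ≤ (2 * (k : ℤ) ^ 3 + 1) ^ 4 :=
    pow_le_pow_right₀ (by omega) (by norm_num)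
  have q5 : (2 * (k : ℤ) ^ 2) ^ 2 ≤ (2 * (k : ℤ) ^ 2) ^ 2 * (2 * (k : ℤ) ^ 3 + 1) ^ 4 :=
    le_mul_of_one_le_right (by positivity) q3
  have q6 : (2 * (k : ℤ) ^ 3 + 1) ^ 4 ≤ (2 * (k : ℤ) ^ 2) ^ 2 * (2 * (k : ℤ) ^ 3 + 1) ^ 4 :=
    le_mul_of_one_le_left (by positivity) q1
  unfold constantsProgram
  refine halts_seq (halts_op ((k : ℤ) ^ 2) (by simp [Op.eval, h3]; ring) (by rw [abs_le]; omega) ?_)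
  refine halts_seq (halts_op (2 * (k : ℤ) ^ 2) (by simp [Op.eval]; ring)
    (by rw [abs_le]; omega) ?_)
  refine halts_seq (halts_op (3 * (k : ℤ) ^ 2) (by simp [Op.eval]; ring)
    (by rw [abs_le]; omega) ?_)
  refine halts_seq (halts_op (3 * (k : ℤ) ^ 2 + 1) (by simp [Op.eval, h2])
    (by rw [abs_le]; omega) ?_)
  refine halts_seq (halts_op ((k : ℤ) ^ 3) (by simp [Op.eval, h3]; ring)
    (by rw [abs_le]; omega) ?_)
  refine halts_seq (halts_op (2 * (k : ℤ) ^ 3) (by simp [Op.eval]; ring)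
    (by rw [abs_le]; omega) ?_)
  refine halts_seq (halts_op (2 * (k : ℤ) ^ 3 + 1) (by simp [Op.eval, h2])
    (by rw [abs_le]; omega) ?_)
  refine halts_seq (halts_op (2 * (k : ℤ) ^ 2) (by simp [Op.eval]; ring)
    (by rw [abs_le]; omega) ?_)
  refine halts_seq (halts_op ((2 * (k : ℤ) ^ 2) ^ 2) (by simp [Op.eval]; ring)
    (by rw [abs_le]; omega) ?_)
  refine halts_seq (halts_op ((2 * (k : ℤ) ^ 3 + 1) ^ 2) (by simp [Op.eval]; ring)
    (by rw [abs_le]; omega) ?_)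
  refine halts_seq (halts_op ((2 * (k : ℤ) ^ 3 + 1) ^ 4) (by simp [Op.eval]; ring)
    (by rw [abs_le]; omega) ?_)
  refine halts_seq (halts_op ((2 * (k : ℤ) ^ 2) ^ 2 * (2 * (k : ℤ) ^ 3 + 1) ^ 4)
    (by simp [Op.eval]) (by rw [abs_le]; omega) ?_)
  iterate 3 refine halts_seq (halts_const (by rw [abs_le]; omega) ?_)
  iterate 2 refine halts_seq (halts_const (by rw [abs_le]; omega) ?_)
  iterate 2 refine halts_seq (halts_const (by rw [abs_le]; omega) ?_)
  refine halts_const (by rw [abs_le]; omega) ?_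
  refine ⟨by norm_num, ⟨?_, ?_, ?_, ?_, ?_, ?_⟩, ?_, ⟨?_, ?_, ?_, ?_, ?_, ?_, ?_, ?_⟩⟩
  case refine_6 =>
    intro z hz
    have hne : ∀ y : ℤ, y < 0 → z ≠ y := fun y hy => by omega
    simp [hne, hin z hz]
  all_goals simp [h1, h2, Coords.det]

/-! ### The output and the whole algorithm -/

/-- Write the output. -/
def outputProgram : Program :=
  .seq (.op .add 0 (-8) (-1)) <|
  .seq (.op .add 1 (-9) (-1)) <|
  .seq (.op .add 2 (-10) (-1)) <|
  .seq (.op .add 3 (-11) (-1)) <|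
  -- The second vector is (c, -d), so its last coordinate changes sign.
  .seq (.op .add 4 (-12) (-1)) (.op .sub 5 (-1) (-13))

theorem halts_outputProgram {B n k : ℕ} (hB : Fits B n k) {w h : Fin n → ℕ}
    {M : Memory} (hM : Ready w h k M) {c : Candidate} (hc : c.InRange k) (hMc : Holds M (-7) c) :
    Halts B outputProgram M fun t M' => t ≤ 6 ∧ M' 0 = c.D₁ ∧ M' 1 = c.D₂ ∧ M' 2 = c.s.a ∧
      M' 3 = c.s.b ∧ M' 4 = c.s.c ∧ M' 5 = -c.s.d := by
  obtain ⟨g1, g2, g3, g4, g5, g6, -, -⟩ := hMc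
  norm_num at g1 g2 g3 g4 g5 g6
  have z0 := hM.zero
  have b1 := hB.walk
  have b2 : (2 : ℤ) * k ^ 2 ≤ B := by
    have := hB.fuel
    zify at this
    nlinarith
  obtain ⟨h1, h2, h3, h4, ⟨sa, sb, sc, sd⟩, ⟨ba, bb, bc, bd⟩⟩ := hc
  unfold outputProgram
  refine halts_seq (halts_op c.D₁ (by simp [Op.eval, z0, g1]) (by rw [abs_le]; omega) ?_)
  refine halts_seq (halts_op c.D₂ (by simp [Op.eval, z0, g2]) (by rw [abs_le]; omega) ?_)
  refine halts_seq (halts_op c.s.a (by simp [Op.eval, z0, g3]) (by rw [abs_le]; omega) ?_)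
  refine halts_seq (halts_op c.s.b (by simp [Op.eval, z0, g4]) (by rw [abs_le]; omega) ?_)
  refine halts_seq (halts_op c.s.c (by simp [Op.eval, z0, g5]) (by rw [abs_le]; omega) ?_)
  refine halts_op (-c.s.d) (by simp [Op.eval, z0, g6]) (by rw [abs_le]; omega) ?_
  refine ⟨by norm_num, ?_, ?_, ?_, ?_, ?_, ?_⟩ <;> simp

/-- The algorithm. -/
def latticeProgram : Program :=
  .seq extentProgram <| .seq constantsProgram <| .seq searchProgram outputProgram

/-- A candidate that is at least as good as all others in its range is optimal. -/
theorem Candidate.Sound.isOptimal {n k : ℕ} (hn : 0 < n) {w h : Fin n → ℕ} (hw : ∀ i, 1 ≤ w i)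
    (hh : ∀ i, 1 ≤ h i) (hwk : ∀ i, w i ≤ k) (hhk : ∀ i, h i ≤ k) {b : Candidate}
    (hb : b.InRange k) (hbs : b.Sound w h)
    (hmax : ∀ c : Candidate, c.InRange k → (∀ i, c.Passes k (w i) (h i)) → c.value ≤ b.value) :
    IsOptimalPiercingLattice w h (b.s.lattice b.D₁ b.D₂) := by
  have hD₁ : (0 : ℝ) < b.D₁ := by exact_mod_cast (by linarith [hb.one_le_D₁] : 0 < b.D₁)
  have hD₂ : (0 : ℝ) < b.D₂ := by exact_mod_cast (by linarith [hb.one_le_D₂] : 0 < b.D₂)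
  have hdet : 0 < (b.s.a / b.D₁ : ℝ) * (b.s.d / b.D₂) + (b.s.b / b.D₂) * (b.s.c / b.D₁) := by
    rw [Coords.div_det]
    have : (0 : ℝ) < b.s.det := by exact_mod_cast hbs.det_pos
    positivity
  have hcov : ZLattice.covolume (b.s.lattice b.D₁ b.D₂) = b.value := by
    rw [Coords.lattice, covolume_gen hdet, Coords.div_det, Candidate.value, Int.cast_mul]
  refine ⟨isLattice_gen hdet, isPiercing_iff.2 hbs.pierces, fun L hL hP => ?_⟩
  obtain ⟨D₁, D₂, A, B, C, D, h1, h2, h3, h4, hA, hB, hC, hD, hAC, hBk, hDk, hdet', hle, hpierce⟩ :=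
    exists_rational_lattice hn hw hh hwk hhk hL (isPiercing_iff.1 hP)
  set c : Candidate := ⟨D₁, D₂, ⟨A, B, C, D⟩⟩ with hc
  have hkD₁ : (k : ℤ) * D₁ ≤ 2 * k ^ 3 := by
    have := mul_le_mul_of_nonneg_left h2 (Int.natCast_nonneg k)
    calc _ ≤ _ := this
      _ = _ := by ring
  have hkD₂ : (k : ℤ) * D₂ ≤ 2 * k ^ 3 := by
    have := mul_le_mul_of_nonneg_left h4 (Int.natCast_nonneg k)
    calc _ ≤ _ := this
      _ = _ := by ring
  have hACk : A + C ≤ k * D₁ := (hAC ⟨0, hn⟩).trans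
    (mul_le_mul_of_nonneg_right (by exact_mod_cast hwk _) (by omega))
  have hcR : c.InRange k := ⟨h1, h2, h3, h4, ⟨hA, hB, hC, hD⟩,
    ⟨by simp only [hc]; omega, by simp only [hc]; omega, by simp only [hc]; omega,
      by simp only [hc]; omega⟩⟩
  -- The rational lattice that dominates the competitor is in the range, and its area of at least 1
  -- lets the walk finish in time. So the search took it into account.
  have hpass : ∀ i, c.Passes k (w i) (h i) := fun i =>
    Coords.Pierced.accepts (k := k) (by simp only [hc]; omega) (by simp only [hc]; omega) (hwk i)
      ⟨⟨hA, hB, hC, hD⟩, hdet', hpierce i, hAC i, hBk, hDk⟩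
  have hval : ZLattice.covolume L ≤ b.value := hle.trans (hmax c hcR hpass)
  obtain ⟨hdisc, hz⟩ := hL
  have hpos : 0 < ZLattice.covolume L := ZLattice.covolume_pos L _
  rw [density, density, hcov]
  exact one_div_le_one_div_of_le hpos hval

theorem count_le {k : ℕ} (hk : 1 ≤ k) :
    (2 * k ^ 2) ^ 2 * (2 * k ^ 3 + 1) ^ 4 ≤ 324 * k ^ 16 := by
  have h3 : 1 ≤ k ^ 3 := Nat.one_le_pow _ _ hk
  calc (2 * k ^ 2) ^ 2 * (2 * k ^ 3 + 1) ^ 4 ≤ (2 * k ^ 2) ^ 2 * (3 * k ^ 3) ^ 4 := by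
        gcongr; omega
    _ = 324 * k ^ 16 := by ring

theorem fits_of_le {B n k : ℕ} (hk : 1 ≤ k) (hn : 2 * n ≤ B) (hB : 324 * k ^ 16 ≤ B) :
    Fits B n k := by
  have hpow : ∀ j ≤ 16, k ^ j ≤ k ^ 16 := fun j hj => Nat.pow_le_pow_right hk hj
  have h2 := hpow 2 (by norm_num)
  have h3 := hpow 3 (by norm_num)
  have h10 := hpow 10 (by norm_num)
  have h16 : 1 ≤ k ^ 16 := Nat.one_le_pow _ _ hk
  refine ⟨by exact_mod_cast hn, ?_, by omega, ?_, ?_⟩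
  · exact_mod_cast (by omega : 2 * (2 * k ^ 3) + 1 ≤ B)
  · have : 2 * (2 * k ^ 3) ^ 2 * (2 * k ^ 2) ^ 2 ≤ B := by
      have e : 2 * (2 * k ^ 3) ^ 2 * (2 * k ^ 2) ^ 2 = 32 * k ^ 10 := by ring
      omega
    exact_mod_cast this
  · exact_mod_cast (count_le hk).trans hB

/-- The running time in terms of the number of candidates. -/
theorem time_le {n k N : ℕ} (hk : 1 ≤ k) (hn : 1 ≤ n) (hN : N ≤ 324 * k ^ 16) :
    2 * n * 6 + 3 + (20 + (N * (n * ((3 * k ^ 2 + 1) * 14 + 26) + 49) + 1 + 6)) ≤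
      100000 * (k ^ 18 * n) := by
  have h2 : 1 ≤ k ^ 2 := Nat.one_le_pow _ _ hk
  have h18 : 1 ≤ k ^ 18 := Nat.one_le_pow _ _ hk
  -- Here 131 = 42 + 40 + 49, and 42444 = 324 · 131 below.
  have h1 : n * ((3 * k ^ 2 + 1) * 14 + 26) + 49 ≤ 131 * (n * k ^ 2) := by nlinarith
  have h3 : N * (n * ((3 * k ^ 2 + 1) * 14 + 26) + 49) ≤ 42444 * (k ^ 18 * n) :=
    (Nat.mul_le_mul hN h1).trans (le_of_eq (by ring))
  have h4 : n ≤ k ^ 18 * n := Nat.le_mul_of_pos_left n h18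
  omega

theorem halts_latticeProgram {B n : ℕ} (hn : 1 ≤ n) {w h : Fin n → ℕ} (hw : ∀ i, 1 ≤ w i)
    (hh : ∀ i, 1 ≤ h i) {k : ℕ} (hk : k = maxExtent w h) (hnB : 2 * n ≤ B)
    (hB : 324 * k ^ 16 ≤ B) :
    Halts B latticeProgram (inputMemory w h) fun t M => t ≤ 100000 * (k ^ 18 * n) ∧
      0 < M 0 ∧ M 0 ≤ 2 * (k : ℤ) ^ 2 ∧ 0 < M 1 ∧ M 1 ≤ 2 * (k : ℤ) ^ 2 ∧
      LinearIndependent ℝ (outputVectors M) ∧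
      IsOptimalPiercingLattice w h (Submodule.span ℤ (Set.range (outputVectors M))) := by
  have hwk : ∀ i, w i ≤ k := fun i => hk ▸ width_le_maxExtent w h i
  have hhk : ∀ i, h i ≤ k := fun i => hk ▸ height_le_maxExtent w h i
  have hk1 : 1 ≤ k := (hw ⟨0, hn⟩).trans (hwk _)
  have hfit := fits_of_le hk1 hnB hB
  have hkB : maxExtent w h ≤ B := by
    have : k ^ 1 ≤ k ^ 16 := Nat.pow_le_pow_right hk1 (by norm_num)
    rw [pow_one] at this
    rw [← hk]
    omega
  refine halts_seq ((halts_extentProgram hn hnB hkB).mono ?_)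
  rintro t₁ M₁ ⟨ht₁, h1, h2, h3, h5⟩
  rw [← hk] at h3
  refine halts_seq ((halts_constantsProgram hfit hk1 h1 h2 h3 h5).mono ?_)
  rintro t₂ M₂ ⟨ht₂, hR₂, hN₂, hb₂⟩
  have hk2 : (1 : ℤ) ≤ 2 * (k : ℤ) ^ 2 := by
    have : 0 < 2 * (k : ℤ) ^ 2 := by positivity
    omega
  have hk3 : (1 : ℤ) ≤ 2 * (k : ℤ) ^ 3 := by
    have : 0 < 2 * (k : ℤ) ^ 3 := by positivity
    omega
  have hk3' : (0 : ℤ) ≤ 2 * (k : ℤ) ^ 3 := by omega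
  have hrange : Candidate.InRange k ⟨1, 1, ⟨1, 0, 0, 1⟩⟩ :=
    ⟨le_rfl, hk2, le_rfl, hk2, ⟨zero_le_one, le_rfl, le_rfl, zero_le_one⟩, ⟨hk3, hk3', hk3', hk3⟩⟩
  have hsound : Candidate.Sound w h ⟨1, 1, ⟨1, 0, 0, 1⟩⟩ := by
    refine ⟨by simp [Coords.det], fun i => ?_⟩
    refine gen_pierces (by simp) (by simp) (by simp) (by simp) (by simp) ?_ (by simp) ?_
    · simpa using hw i
    · simpa using hh i
  refine halts_seq ((halts_searchProgram hfit hk1 hwk hhk hR₂ hrange hb₂ hsound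
    (N := (2 * k ^ 2) ^ 2 * (2 * k ^ 3 + 1) ^ 4) (by push_cast; ring)
    (by rw [hN₂]; push_cast; ring)).mono ?_)
  rintro t₃ M₃ ⟨ht₃, hR₃, b, hb, hbs, hMb, hmax⟩
  refine (halts_outputProgram hfit hR₃ hb hMb).mono ?_
  rintro t₄ M₄ ⟨ht₄, o0, o1, o2, o3, o4, o5⟩
  have hD₁ : (0 : ℝ) < b.D₁ := by exact_mod_cast (by linarith [hb.one_le_D₁] : 0 < b.D₁)
  have hD₂ : (0 : ℝ) < b.D₂ := by exact_mod_cast (by linarith [hb.one_le_D₂] : 0 < b.D₂)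
  have hdet : 0 < (b.s.a / b.D₁ : ℝ) * (b.s.d / b.D₂) + (b.s.b / b.D₂) * (b.s.c / b.D₁) := by
    rw [Coords.div_det]
    have : (0 : ℝ) < b.s.det := by exact_mod_cast hbs.det_pos
    positivity
  have hout : outputVectors M₄ = ![![(b.s.a / b.D₁ : ℝ), (b.s.b / b.D₂ : ℝ)],
      ![(b.s.c / b.D₁ : ℝ), -(b.s.d / b.D₂ : ℝ)]] := by
    rw [outputVectors, o0, o1, o2, o3, o4, o5, Int.cast_neg, neg_div]
  refine ⟨?_, by rw [o0]; linarith [hb.one_le_D₁], by rw [o0]; exact hb.D₁_le,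
    by rw [o1]; linarith [hb.one_le_D₂], by rw [o1]; exact hb.D₂_le, ?_, ?_⟩
  · exact le_trans (by omega) (time_le hk1 hn (count_le hk1))
  · rw [hout]
    exact linearIndependent_of_det_pos hdet
  · rw [hout, ← gen_eq_span_range]
    exact hbs.isOptimal hn hw hh hwk hhk hb hmax

end Piercing

theorem mainTheorem6 :
    ∃ (p : RAM.Program) (C : ℕ),
      ∀ (n : ℕ) (w h : Fin n → ℕ), 1 ≤ n → (∀ i, 1 ≤ w i) → (∀ i, 1 ≤ h i) →
        ∀ k : ℕ, k = Piercing.maxExtent w h →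
          ∃ (t : ℕ) (M : RAM.Memory),
            RAM.Runs (C * (k + n) ^ C) p (Piercing.inputMemory w h) t M ∧
            (t : ℝ) ≤ C * ((k : ℝ) ^ 18 * ((k : ℝ) + n) * Real.log (k + 1)) ∧
            0 < M 0 ∧ M 0 ≤ C * (k : ℤ) ^ 2 ∧
            0 < M 1 ∧ M 1 ≤ C * (k : ℤ) ^ 2 ∧
            LinearIndependent ℝ (Piercing.outputVectors M) ∧
            Piercing.IsOptimalPiercingLattice w h
              (Submodule.span ℤ (Set.range (Piercing.outputVectors M))) := by
  -- The constant is kept opaque because it is also an exponent. It is twice the factor 100000 of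
  -- the running time, to make up for log (k + 1) ≥ 1/2.
  obtain ⟨C, hC⟩ : ∃ C : ℕ, 200000 ≤ C := ⟨_, le_rfl⟩
  refine ⟨Piercing.latticeProgram, C, fun n w h hn hw hh k hk => ?_⟩
  have hk1 : 1 ≤ k := (hw ⟨0, hn⟩).trans (hk ▸ Piercing.width_le_maxExtent w h _)
  have hpow : ∀ j ≤ C, (k + n) ^ j ≤ (k + n) ^ C := fun j hj =>
    Nat.pow_le_pow_right (by omega) hj
  have hnB : 2 * n ≤ C * (k + n) ^ C :=
    Nat.mul_le_mul (by omega) ((by rw [pow_one]; omega : n ≤ (k + n) ^ 1).trans (hpow 1 (by omega)))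
  have hB : 324 * k ^ 16 ≤ C * (k + n) ^ C :=
    Nat.mul_le_mul (by omega) ((Nat.pow_le_pow_left (by omega) 16).trans (hpow 16 (by omega)))
  obtain ⟨t, M, hrun, ht, h0, h0', h1, h1', hli, hopt⟩ :=
    Piercing.halts_latticeProgram hn hw hh hk hnB hB
  have hC2 : (2 : ℤ) * k ^ 2 ≤ C * k ^ 2 :=
    mul_le_mul_of_nonneg_right (by omega) (by positivity)
  refine ⟨t, M, hrun, ?_, h0, h0'.trans hC2, h1, h1'.trans hC2, hli, hopt⟩
  have hkr : (1 : ℝ) ≤ k := by exact_mod_cast hk1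
  have hlog : 1 / 2 ≤ Real.log (k + 1) := by
    have := Real.log_le_log (by norm_num) (by linarith : (2 : ℝ) ≤ k + 1)
    linarith [Real.log_two_gt_d9]
  have hCr : (200000 : ℝ) ≤ C := by exact_mod_cast hC
  have hX : (k : ℝ) ^ 18 * n ≤ (k : ℝ) ^ 18 * (k + n) := by gcongr; linarith
  have ht' : (t : ℝ) ≤ 100000 * ((k : ℝ) ^ 18 * n) := by exact_mod_cast ht
  calc (t : ℝ) ≤ 200000 * ((k : ℝ) ^ 18 * (k + n) * (1 / 2)) := by linarith
    _ ≤ C * ((k : ℝ) ^ 18 * ((k : ℝ) + n) * Real.log (k + 1)) := by gcongr
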